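/- Let $p \ge 5$ be a prime with $p \equiv 3 \pmod 4$. For $n\ge 0$ put $(a)_0=1$, $(a)_n=a(a+1)\cdots(a+n-1)$ and $J_n=\sum_{k=0}^{n}\binom{2k}{k}^2/16^k$. Let $\Gamma_p:\mathbb{Z}_p\to\mathbb{Z}_p$ be the $p$-adic Gamma function, $$\Gamma_p(x)=\lim_{m\to x}(-1)^m\prod_{\substack{0<k<m\\ \gcd(k,p)=1}}k,$$ where $m$ runs through the non-negative integers tending $p$-adically to $x$. Then $$\sum_{k=0}^{(p-1)/2}\left(\frac{(1/2)_k}{k!}\right)^3\equiv-\frac{p^2}{4}\,\Gamma_p\!\left(\tfrac14\right)^4 J_{(p-3)/4}^2\pmod{p^4},$$ and moreover $J_{(p-3)/4}\equiv-\tfrac12\pmod p$. Here $x\equiv y\pmod{p^n}$ means $x-y\in p^n\mathbb{Z}_p$. -/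

import Mathlib

/-- The values at natural numbers of the `p`-adic Gamma function: the product of
`(-1)^m` and all `k` with `0 < k < m` that are prime to `p`. -/
def padicGammaNat (p m : ℕ) : ℤ :=
  (-1) ^ m * ∏ k ∈ (Finset.Ioo 0 m).filter (fun k => Nat.Coprime k p), (k : ℤ)

/-- Morita's `p`-adic Gamma function `Γ_p : ℤ_p → ℤ_p`: the limit of `padicGammaNat p m`
as the natural number `m` tends `p`-adically to `x`. -/
noncomputable def padicGamma (p : ℕ) [Fact p.Prime] (x : ℤ_[p]) : ℤ_[p] :=
  Filter.limUnder (Filter.comap (fun m : ℕ => (m : ℤ_[p])) (nhds x))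
    (fun m : ℕ => ((padicGammaNat p m : ℤ) : ℤ_[p]))

/-- `x ≡ y (mod p ^ n)`: the difference lies in `p ^ n ℤ_p`. -/
def PadicCongr (p : ℕ) [Fact p.Prime] (n : ℕ) (x y : ℚ_[p]) : Prop :=
  ∃ z : ℤ_[p], x - y = (p : ℚ_[p]) ^ n * (z : ℚ_[p])

/-- `J n = ∑_{k=0}^{n} (2k choose k)^2 / 16^k`. -/
def centralBinomSqSum (n : ℕ) : ℚ :=
  ∑ k ∈ Finset.range (n + 1), ((2 * k).choose k : ℚ) ^ 2 / 16 ^ k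

/-- The `p`-adic integer `1/4`, for an odd prime `p`. -/
noncomputable def padicQuarter (p : ℕ) [Fact p.Prime] (hp : p ≠ 2) : ℤ_[p] :=
  ⟨1 / 4, by
    have h2 : ‖((2 : ℕ) : ℚ_[p])‖ = 1 := by
      rw [Padic.norm_natCast_eq_one_iff]
      exact (Nat.coprime_primes Fact.out Nat.prime_two).2 hp
    have h4 : (4 : ℚ_[p]) = ((2 : ℕ) : ℚ_[p]) ^ 2 := by norm_num
    rw [h4, norm_div, norm_pow, h2]
    norm_num⟩

/-! Write p = 4n+3, m = 2n+1 = (p-1)/2, h_k = (1/2)_k/k!, J = J_n, and let H_k be the harmonic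
numbers. The factor p^2 is produced by an exact identity, after which everything is needed only to
first order in p, modulo p^2.

`sum_halfBinom_cube` turns the cube sum into a sum of n+1 terms with the common factor
∏_{j≤n}(2j+3/2)^2, whose last factor is p^2/4. In the remaining terms (j+1/4)^2 differs from
(j-n-1/2)(j+n+1) by p^2/16, so modulo p^2 they may be replaced by the terms of ∑ c_k/(n+1+k), with
c_k the Legendre coefficients of degree n+1/2. The partial sum formula `sum_legendreCoeff_div_add`
evaluates this as a unit times p ∑ C(m,k)^2 (1/(2k+1) - 1/(p-2k)). Its term k = 0 contributes -1;
the rest is p times sums needed only modulo p.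

Those sums, and J itself modulo p^2, involve a single unknown A = `harmDefect`. Since h_k^2 is a
Legendre coefficient of degree m modulo p^2, the full sum of h_k^2 is P_m(-1) = -1, and reflecting k
to m-k gives 2J ≡ -1 + pA. The other sums give -1 + p(2A - H_m), which is -(1-pA)^2 (1+pH_m) modulo
p^2. Thus A is absorbed into J^2, and what remains is to identify the unit times 1+pH_m with
Γ_p(1/4)^4/4. Both sides are reduced to -n!^4 (1-pH_n)/(4(p-1)!): the unit by first-order expansions
of factorial products and of 2^m, the Gamma value by Wilson's theorem modulo prime powers and an
explicit integer close to 1/4. -/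

/-! ### Exact quadratic transformation of the truncated cube series. -/

section Exact

variable {K : Type*} [Field K]

/-- `(1/2)_k / k!`, the normalised central binomial coefficient. -/
def halfBinom (K : Type*) [Field K] (k : ℕ) : K := (Nat.centralBinom k : K) / 4 ^ k

theorem halfBinom_zero : halfBinom K 0 = 1 := by simp [halfBinom]

/-- `(-μ)_k (μ+1)_k / k!^2`, the coefficients of the Legendre function of degree `μ`. -/
def legendreCoeff (μ : K) (k : ℕ) : K :=
  ∏ j ∈ Finset.range k, ((j - μ) * (j + μ + 1) / ((j : K) + 1) ^ 2)

theorem legendreCoeff_succ (μ : K) (k : ℕ) :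
    legendreCoeff μ (k + 1)
      = legendreCoeff μ k * ((k - μ) * (k + μ + 1) / ((k : K) + 1) ^ 2) := by
  rw [legendreCoeff, legendreCoeff, Finset.prod_range_succ]

theorem legendreCoeff_zero (μ : K) : legendreCoeff μ 0 = 1 := by simp [legendreCoeff]

/-- The summand of the transformed cube sum. -/
def cubeTerm (K : Type*) [Field K] (n k : ℕ) : K :=
  (∏ j ∈ Finset.range (n + 1), (2 * (j : K) + 3 / 2) ^ 2) / ((2 * n + 2).factorial : K) *
    ∏ j ∈ Finset.range k,
      (((n : K) + 3 / 2 + j) * ((j : K) + 1 / 4) ^ 2 / (((j : K) + 1) ^ 2 * (n + 2 + j)))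

theorem cubeTerm_succ_right (n k : ℕ) :
    cubeTerm K n (k + 1) = cubeTerm K n k *
      (((n : K) + 3 / 2 + k) * ((k : K) + 1 / 4) ^ 2 / (((k : K) + 1) ^ 2 * (n + 2 + k))) := by
  rw [cubeTerm, cubeTerm, Finset.prod_range_succ _ k, mul_assoc]

variable [CharZero K]

theorem halfBinom_succ (k : ℕ) :
    halfBinom K (k + 1) = halfBinom K k * (2 * k + 1) / (2 * (k + 1)) := by
  have h : ((k : K) + 1) * (Nat.centralBinom (k + 1) : K)
      = 2 * (2 * k + 1) * Nat.centralBinom k := by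
    exact_mod_cast Nat.succ_mul_centralBinom_succ k
  have hk : (k : K) + 1 ≠ 0 := by exact_mod_cast k.succ_ne_zero
  unfold halfBinom
  rw [pow_succ, div_mul_eq_mul_div, div_div, div_eq_div_iff (by simp) (by simp [hk])]
  linear_combination 2 * 4 ^ k * h

theorem cubeTerm_succ_left (n k : ℕ) :
    cubeTerm K (n + 1) k = cubeTerm K n k *
      ((2 * n + 7 / 2) ^ 2 * (n + 3 / 2 + k) / ((2 * n + 3) ^ 2 * (n + 2 + k))) := by
  have h1 (j : ℕ) : (n : K) + 2 + j ≠ 0 := by exact_mod_cast (by omega : n + 2 + j ≠ 0)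
  have h1' (j : ℕ) : (n : K) + 1 + 2 + j ≠ 0 := by
    exact_mod_cast (by omega : n + 1 + 2 + j ≠ 0)
  have h2 : 2 * (n : K) + 3 ≠ 0 := by exact_mod_cast (by omega : 2 * n + 3 ≠ 0)
  have h3 (j : ℕ) : 2 * (n : K) + 3 + 2 * j ≠ 0 := by
    exact_mod_cast (by omega : 2 * n + 3 + 2 * j ≠ 0)
  have h4 : (n : K) + 2 ≠ 0 := by simpa using h1 0
  induction k with
  | zero =>
    have hf : ((2 * (n + 1) + 2).factorial : K)
        = (2 * n + 4) * ((2 * n + 3) * (2 * n + 2).factorial) := by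
      rw [show 2 * (n + 1) + 2 = (2 * n + 2 + 1) + 1 by ring, Nat.factorial_succ,
        Nat.factorial_succ]
      push_cast
      ring
    have hf0 : ((2 * n + 2).factorial : K) ≠ 0 := by exact_mod_cast Nat.factorial_ne_zero _
    have h5 : 2 * (n : K) + 4 ≠ 0 := by exact_mod_cast (by omega : 2 * n + 4 ≠ 0)
    simp only [cubeTerm, Finset.range_zero, Finset.prod_empty, mul_one, Nat.cast_zero, add_zero]
    rw [Finset.prod_range_succ, hf]
    push_cast
    field_simp
    ring
  | succ k ih =>
    have a1 := h1 k
    have a2 := h1' k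
    have a3 := h1 (k + 1)
    have a4 : (k : K) + 1 ≠ 0 := by exact_mod_cast k.succ_ne_zero
    rw [cubeTerm_succ_right, cubeTerm_succ_right, ih]
    push_cast at a3 ⊢
    have a5 : (n : K) + 2 + (k + 1) = n + 1 + 2 + k := by ring
    rw [a5] at a3 ⊢
    field_simp
    ring

/-- A Wilf–Zeilberger pair: the companion of F = `cubeTerm` is G(n,k) = 4k^2 F(n,k)/(2n+3)^2, which
vanishes at k = 0. -/
theorem cubeTerm_telescope (n k : ℕ) :
    cubeTerm K (n + 1) k - cubeTerm K n k
      = 4 * ((k : K) + 1) ^ 2 / (2 * n + 3) ^ 2 * cubeTerm K n (k + 1)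
        - 4 * (k : K) ^ 2 / (2 * n + 3) ^ 2 * cubeTerm K n k := by
  have h1 : (n : K) + 2 + k ≠ 0 := by exact_mod_cast (by omega : n + 2 + k ≠ 0)
  have h2 : 2 * (n : K) + 3 ≠ 0 := by exact_mod_cast (by omega : 2 * n + 3 ≠ 0)
  have h4 : (k : K) + 1 ≠ 0 := by exact_mod_cast k.succ_ne_zero
  rw [cubeTerm_succ_right, cubeTerm_succ_left]
  field_simp
  ring

/-- Identifies the boundary terms of the telescoping: just past its range, the transformed sum
continues with the next term of the cube series. -/
theorem cubeTerm_diagonal (n : ℕ) : cubeTerm K n (n + 1) = halfBinom K (2 * n + 2) ^ 3 := by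
  induction n with
  | zero =>
    simp [cubeTerm, halfBinom_succ, halfBinom_zero, Nat.factorial]
    norm_num
  | succ n ih =>
    have h1 : 2 * (n : K) + 3 ≠ 0 := by exact_mod_cast (by omega : 2 * n + 3 ≠ 0)
    have h2 : (n : K) + 2 ≠ 0 := by exact_mod_cast (by omega : n + 2 ≠ 0)
    rw [cubeTerm_succ_right, cubeTerm_succ_left, ih,
      show 2 * (n + 1) + 2 = (2 * n + 2 + 1) + 1 by ring,
      halfBinom_succ (2 * n + 2 + 1), halfBinom_succ (2 * n + 2)]
    push_cast
    have e1 : (n : K) + 1 + 2 + (n + 1) = 2 * (n + 2) := by ring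
    have e2 : (n : K) + 2 + (n + 1) = 2 * n + 3 := by ring
    have e3 : 2 * (n : K) + 2 + 1 = 2 * n + 3 := by ring
    have e4 : 2 * (n : K) + 3 + 1 = 2 * (n + 2) := by ring
    have e5 : (n : K) + 1 + 1 = n + 2 := by ring
    simp only [e1, e2, e3, e4, e5]
    field_simp
    ring

/-- A quadratic transformation of the truncated series `∑ ((1/2)_k / k!)^3`. -/
theorem sum_halfBinom_cube (n : ℕ) :
    ∑ k ∈ Finset.range (2 * n + 2), halfBinom K k ^ 3
      = ∑ k ∈ Finset.range (n + 1), cubeTerm K n k := by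
  induction n with
  | zero =>
    simp [Finset.sum_range_succ, cubeTerm, halfBinom_succ, halfBinom_zero, Nat.factorial]
    norm_num
  | succ n ih =>
    have h1 : 2 * (n : K) + 3 ≠ 0 := by exact_mod_cast (by omega : 2 * n + 3 ≠ 0)
    have h2 : (n : K) + 2 ≠ 0 := by exact_mod_cast (by omega : n + 2 ≠ 0)
    -- The range is one longer than the sum for n. The extra term F(n,n+1) is h_{2n+2}^3 and the
    -- boundary value G(n,n+2) is h_{2n+3}^3: exactly the two new cubes.
    have key : ∑ k ∈ Finset.range (n + 2), (cubeTerm K (n + 1) k - cubeTerm K n k)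
        = 4 * ((n : K) + 2) ^ 2 / (2 * n + 3) ^ 2 * cubeTerm K n (n + 2) := by
      rw [Finset.sum_congr rfl fun k _ => cubeTerm_telescope n k]
      have := Finset.sum_range_sub
        (fun k : ℕ => 4 * (k : K) ^ 2 / (2 * n + 3) ^ 2 * cubeTerm K n k) (n + 2)
      push_cast at this
      rw [this]
      simp
    rw [Finset.sum_sub_distrib, Finset.sum_range_succ (fun k => cubeTerm K n k), ← ih,
      cubeTerm_succ_right n (n + 1), cubeTerm_diagonal] at key
    rw [show 2 * (n + 1) + 2 = (2 * n + 2) + 1 + 1 by ring, Finset.sum_range_succ,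
      Finset.sum_range_succ, halfBinom_succ (2 * n + 2)]
    rw [show n + 1 + 1 = n + 2 by ring, eq_add_of_sub_eq key]
    push_cast
    have e2 : (n : K) + 2 + (n + 1) = 2 * n + 3 := by ring
    have e3 : 2 * (n : K) + 2 + 1 = 2 * n + 3 := by ring
    have e5 : (n : K) + 1 + 1 = n + 2 := by ring
    simp only [e2, e3, e5]
    field_simp
    ring

end Exact

/-! ### Exact Legendre sums, an interpolation formula, and convolutions of h_k. -/

section Exact

variable {K : Type*} [Field K]

theorem legendreCoeff_eq_zero {m k : ℕ} (h : m < k) : legendreCoeff (m : K) k = 0 :=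
  Finset.prod_eq_zero (Finset.mem_range.2 h) (by simp)

/-- The harmonic number, as an element of a field. -/
def harm (K : Type*) [Field K] (n : ℕ) : K := ∑ i ∈ Finset.range n, 1 / ((i : K) + 1)

theorem harm_succ (n : ℕ) : harm K (n + 1) = harm K n + 1 / ((n : K) + 1) := by
  rw [harm, harm, Finset.sum_range_succ]

/-- `(1-y)_s / (y)_s`. -/
def reflRatio (y : K) (s : ℕ) : K := ∏ i ∈ Finset.range s, ((i + 1 - y) / (y + i))

theorem reflRatio_succ (y : K) (s : ℕ) :
    reflRatio y (s + 1) = reflRatio y s * ((s + 1 - y) / (y + s)) := by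
  rw [reflRatio, reflRatio, Finset.prod_range_succ]

theorem factorial_sub_mul_factorial_add {N r : ℕ} (h : r ≤ N) :
    ((N + 1 - r).factorial : K) = (N + 1 - r) * (N - r).factorial ∧
    ((N + 1 + r).factorial : K) = (N + 1 + r) * (N + r).factorial := by
  constructor
  · rw [show N + 1 - r = (N - r) + 1 by omega, Nat.factorial_succ]
    push_cast [Nat.cast_sub h]
    ring
  · rw [show N + 1 + r = (N + r) + 1 by omega, Nat.factorial_succ]
    push_cast
    ring

/-- `∑_{k ≤ n} ((1/2)_k / k!)^2`. -/
def halfBinomSqSum (K : Type*) [Field K] (n : ℕ) : K :=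
  ∑ k ∈ Finset.range (n + 1), halfBinom K k ^ 2

theorem halfBinomSqSum_succ (n : ℕ) :
    halfBinomSqSum K (n + 1) = halfBinomSqSum K n + halfBinom K (n + 1) ^ 2 := by
  rw [halfBinomSqSum, Finset.sum_range_succ, ← halfBinomSqSum]

variable [CharZero K]

theorem legendreCoeff_shift (μ : K) (k : ℕ) :
    legendreCoeff (μ + 1) (k + 1)
      = -((k + 1 + μ) * (k + 2 + μ) / ((k : K) + 1) ^ 2 * legendreCoeff μ k) := by
  induction k with
  | zero =>
    rw [legendreCoeff_succ, legendreCoeff_zero, legendreCoeff_zero]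
    push_cast
    ring
  | succ k ih =>
    have h1 : (k : K) + 1 ≠ 0 := by exact_mod_cast k.succ_ne_zero
    have h2 : (k : K) + 1 + 1 ≠ 0 := by exact_mod_cast (k + 1).succ_ne_zero
    rw [legendreCoeff_succ, ih, legendreCoeff_succ μ k]
    push_cast
    field_simp
    ring

/-- The contiguous relation between degrees μ and μ+1 makes this combination telescope. For integral
μ = m and N > m the right side vanishes, which drives the induction on the degree. -/
theorem sum_legendreCoeff_add {μ : K} (hμ : μ + 1 ≠ 0) (N : ℕ) :
    ∑ k ∈ Finset.range (N + 1), (legendreCoeff (μ + 1) k + legendreCoeff μ k)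
      = 2 * (N + 1 + μ) / (μ + 1) * legendreCoeff μ N := by
  induction N with
  | zero =>
    simp [legendreCoeff_zero]
    field_simp
    ring
  | succ N ih =>
    have h1 : (N : K) + 1 ≠ 0 := by exact_mod_cast N.succ_ne_zero
    rw [Finset.sum_range_succ, ih, legendreCoeff_shift μ, legendreCoeff_succ μ N]
    push_cast
    field_simp
    ring

/-- This is the value P_m(-1) of the Legendre polynomial. -/
theorem sum_legendreCoeff (m : ℕ) :
    ∑ k ∈ Finset.range (m + 1), legendreCoeff (m : K) k = (-1) ^ m := by
  induction m with
  | zero => simp [legendreCoeff_zero]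
  | succ m ih =>
    have h := sum_legendreCoeff_add (μ := (m : K)) (by exact_mod_cast m.succ_ne_zero) (m + 1)
    rw [legendreCoeff_eq_zero (Nat.lt_succ_self m), mul_zero, Finset.sum_add_distrib,
      Finset.sum_range_succ (fun k => legendreCoeff (m : K) k), ih,
      legendreCoeff_eq_zero (Nat.lt_succ_self m)] at h
    push_cast
    rw [pow_succ]
    linear_combination h

theorem sum_legendreCoeff_sub_div {μ : K} (hμ : μ + 1 ≠ 0) (N : ℕ) :
    ∑ k ∈ Finset.range N,
        (legendreCoeff (μ + 1) (k + 1) - legendreCoeff μ (k + 1)) / ((k : K) + 1)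
      = 2 * (N + 1 + μ) / (μ + 1) ^ 2 * legendreCoeff μ N - 2 / (μ + 1) := by
  induction N with
  | zero =>
    simp [legendreCoeff_zero]
    field_simp
    ring
  | succ N ih =>
    have h1 : (N : K) + 1 ≠ 0 := by exact_mod_cast N.succ_ne_zero
    rw [Finset.sum_range_succ, ih, legendreCoeff_shift μ, legendreCoeff_succ μ N]
    push_cast
    field_simp
    ring

/-- By the preceding telescoping, raising the degree from m to m+1 changes the sum by -2/(m+1). -/
theorem sum_legendreCoeff_div (m : ℕ) :
    ∑ k ∈ Finset.range m, legendreCoeff (m : K) (k + 1) / ((k : K) + 1) = -2 * harm K m := by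
  induction m with
  | zero => simp [harm]
  | succ m ih =>
    have h := sum_legendreCoeff_sub_div (μ := (m : K)) (by exact_mod_cast m.succ_ne_zero) (m + 1)
    simp only [sub_div] at h
    rw [legendreCoeff_eq_zero (Nat.lt_succ_self m), mul_zero, Finset.sum_sub_distrib,
      Finset.sum_range_succ (fun k : ℕ => legendreCoeff (m : K) (k + 1) / ((k : K) + 1)), ih,
      legendreCoeff_eq_zero (Nat.lt_succ_self m)] at h
    rw [harm_succ]
    push_cast
    linear_combination h

/-- Up to sign, this compares leading coefficients in μ(μ+1) in the interpolation formula below; the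
proof is a direct telescoping in s. -/
theorem sum_reflRatio {y : K} (hy : ∀ i : ℕ, y + i ≠ 0) (N : ℕ) :
    ∑ s ∈ Finset.range (N + 1), (-1) ^ s * (2 * s + 1) * (reflRatio y s / (y + s)) /
        ((N - s).factorial * (N + 1 + s).factorial : K)
      = 1 / ((N.factorial : K) ^ 2 * (y + N)) := by
  have hf (k : ℕ) : (k.factorial : K) ≠ 0 := by exact_mod_cast Nat.factorial_ne_zero _
  have hN : (N : K) + 1 ≠ 0 := by exact_mod_cast N.succ_ne_zero
  -- Closed form of every partial sum; the boundary term carries N+1-r and disappears at r = N+1.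
  have part : ∀ r ≤ N + 1, ∑ s ∈ Finset.range r,
      (-1) ^ s * (2 * s + 1) * (reflRatio y s / (y + s)) /
        ((N - s).factorial * (N + 1 + s).factorial : K)
      = (1 / (N.factorial : K) ^ 2 - (-1) ^ r * reflRatio y r * (N + 1 - r) /
          ((N + 1 - r).factorial * (N + r).factorial)) / (y + N) := by
    intro r hr
    induction r with
    | zero =>
      simp [reflRatio, Nat.factorial_succ]
      have := hf N
      have := hy N
      field_simp
      ring
    | succ r ih =>
      have hr' : r ≤ N := by omega
      obtain ⟨e1, e2⟩ := factorial_sub_mul_factorial_add (K := K) hr'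
      have hsub : (N : K) + 1 - r ≠ 0 := by
        rw [← Nat.cast_succ, ← Nat.cast_sub (by omega)]
        exact_mod_cast (by omega : N + 1 - r ≠ 0)
      have hadd : (N : K) + 1 + r ≠ 0 := by exact_mod_cast (by omega : N + 1 + r ≠ 0)
      rw [Finset.sum_range_succ, ih (by omega), reflRatio_succ,
        show N + 1 - (r + 1) = N - r by omega, show N + (r + 1) = N + 1 + r by omega, e1, e2]
      have := hf N
      have := hf (N - r)
      have := hf (N + r)
      have := hy N
      have := hy r
      push_cast
      field_simp
      ring
  rw [part (N + 1) le_rfl]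
  push_cast
  rw [sub_self, mul_zero, zero_div, sub_zero, div_div]

/-- A partial sum of a balanced `₃F₂` as a finite very-well-poised sum. -/
theorem sum_legendreCoeff_div_add {y μ : K} (hy : ∀ i : ℕ, y + i ≠ 0)
    (hμ : ∀ s : ℕ, (μ - s) * (μ + s + 1) ≠ 0) (N : ℕ) :
    ∑ k ∈ Finset.range (N + 1), legendreCoeff μ k / (y + k)
      = (-1) ^ N * (∏ l ∈ Finset.range (N + 1), (μ - l) * (μ + l + 1)) *
        ∑ s ∈ Finset.range (N + 1), (-1) ^ s * (2 * s + 1) * (reflRatio y s / (y + s)) /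
          ((N - s).factorial * (N + 1 + s).factorial : K) / ((μ - s) * (μ + s + 1)) := by
  have hf (k : ℕ) : (k.factorial : K) ≠ 0 := by exact_mod_cast Nat.factorial_ne_zero _
  have hleg (k : ℕ) : legendreCoeff μ k
      = (-1) ^ k * (∏ l ∈ Finset.range k, (μ - l) * (μ + l + 1)) / (k.factorial : K) ^ 2 := by
    induction k with
    | zero => simp [legendreCoeff_zero]
    | succ k ih =>
      have h1 : (k : K) + 1 ≠ 0 := by exact_mod_cast k.succ_ne_zero
      have := hf k
      rw [legendreCoeff_succ, ih, Finset.prod_range_succ, Nat.factorial_succ]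
      push_cast
      field_simp
      ring
  induction N with
  | zero =>
    have h0 := hμ 0
    have := hy 0
    simp only [Nat.cast_zero, sub_zero, add_zero] at h0 this
    simp [legendreCoeff_zero, reflRatio]
    field_simp
    rw [div_self h0]
  | succ N ih =>
    -- The formula is Lagrange interpolation in λ = μ(μ+1): the left side has degree N in λ, the
    -- nodes are μ = 0, …, N, and its value at μ = s is `reflRatio y s / (y + s)` by
    -- Pfaff–Saalschütz. The induction adds one node at a time.
    set P := ∏ l ∈ Finset.range (N + 1), (μ - l) * (μ + l + 1) with hP
    have hc := sum_reflRatio hy (N + 1)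
    have hlast := hμ (N + 1)
    have hlegN : legendreCoeff μ (N + 1) / (y + ((N + 1 : ℕ) : K))
        = (-1) ^ (N + 1) * P * (1 / (((N + 1).factorial : K) ^ 2 * (y + ((N + 1 : ℕ) : K)))) := by
      rw [hleg (N + 1), ← hP, div_div, ← mul_one_div]
    -- Rests on (μ-s)(μ+s+1) - (μ-N-1)(μ+N+2) = (N+1-s)(N+2+s), the ratio of the factorial weights
    -- for N+1 and N.
    have hmain : ∀ s ∈ Finset.range (N + 1),
        (-1) ^ s * (2 * s + 1) * (reflRatio y s / (y + s)) /
          ((N - s).factorial * (N + 1 + s).factorial : K) / ((μ - s) * (μ + s + 1))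
        = (-1) ^ s * (2 * s + 1) * (reflRatio y s / (y + s)) /
          ((N + 1 - s).factorial * (N + 1 + 1 + s).factorial : K)
          - (μ - (N + 1 : ℕ)) * (μ + (N + 1 : ℕ) + 1) *
            ((-1) ^ s * (2 * s + 1) * (reflRatio y s / (y + s)) /
            ((N + 1 - s).factorial * (N + 1 + 1 + s).factorial : K) /
              ((μ - s) * (μ + s + 1))) := by
      intro s hs
      have hs' : s ≤ N := by simpa [Nat.lt_succ_iff] using hs
      have e1 := (factorial_sub_mul_factorial_add (K := K) hs').1
      have e2 : ((N + 1 + 1 + s).factorial : K) = (N + 1 + 1 + s) * (N + 1 + s).factorial := by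
        have := (factorial_sub_mul_factorial_add (K := K) (show s ≤ N + 1 by omega)).2
        push_cast at this
        exact this
      have hsub : (N : K) + 1 - s ≠ 0 := by
        rw [← Nat.cast_succ, ← Nat.cast_sub (by omega)]
        exact_mod_cast (by omega : N + 1 - s ≠ 0)
      have hadd : (N : K) + 1 + 1 + s ≠ 0 := by exact_mod_cast (by omega : N + 1 + 1 + s ≠ 0)
      rw [e1, e2]
      have := hf (N - s)
      have := hf (N + 1 + s)
      have := hy s
      have := hμ s
      have hl := left_ne_zero_of_mul this
      have hr := right_ne_zero_of_mul this
      push_cast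
      field_simp
      ring
    rw [Finset.sum_range_succ, ih, hlegN, ← hc, Finset.prod_range_succ _ (N + 1), ← hP,
      Finset.sum_congr rfl hmain, Finset.sum_sub_distrib, ← Finset.mul_sum,
      Finset.sum_range_succ _ (N + 1), Finset.sum_range_succ _ (N + 1)]
    set G := (-1 : K) ^ (N + 1) * (2 * ((N + 1 : ℕ) : K) + 1) *
      (reflRatio y (N + 1) / (y + ((N + 1 : ℕ) : K))) /
        ((N + 1 - (N + 1)).factorial * (N + 1 + 1 + (N + 1)).factorial : K)
    have hG : (μ - (N + 1 : ℕ)) * (μ + (N + 1 : ℕ) + 1) *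
        (G / ((μ - (N + 1 : ℕ)) * (μ + (N + 1 : ℕ) + 1))) = G := mul_div_cancel₀ _ hlast
    rw [pow_succ]
    linear_combination (-1) ^ N * P * hG

/-- The factors 2N+3 and 2N+2 are chosen so that the recurrence of h cancels the denominator 2s+1,
leaving differences of consecutive h. -/
theorem halfBinom_convolution_odd (N : ℕ) :
    (2 * ((N + 1 : ℕ) : K) + 1) *
        ∑ s ∈ Finset.range (N + 2), halfBinom K (N + 1 - s) / (2 * s + 1)
      = 2 * ((N + 1 : ℕ) : K) * ∑ s ∈ Finset.range (N + 1), halfBinom K (N - s) / (2 * s + 1)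
        + halfBinom K (N + 1) := by
  have key : ∀ s ∈ Finset.range (N + 1),
      (2 * ((N + 1 : ℕ) : K) + 1) * (halfBinom K (N + 1 - s) / (2 * s + 1))
        - 2 * ((N + 1 : ℕ) : K) * (halfBinom K (N - s) / (2 * s + 1))
      = halfBinom K (N + 1 - s) - halfBinom K (N + 1 - (s + 1)) := by
    intro s hs
    obtain ⟨k, rfl⟩ : ∃ k, N = k + s := ⟨N - s, by simp at hs; omega⟩
    have h1 : (2 * (s : K) + 1) ≠ 0 := by exact_mod_cast (by omega : 2 * s + 1 ≠ 0)
    have h2 : (k : K) + 1 ≠ 0 := by exact_mod_cast k.succ_ne_zero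
    rw [show k + s + 1 - s = k + 1 by omega, show k + s - s = k by omega,
      show k + s + 1 - (s + 1) = k by omega, halfBinom_succ]
    push_cast
    field_simp
    ring
  have h3 : (2 * ((N + 1 : ℕ) : K) + 1) ≠ 0 := by
    exact_mod_cast (by omega : 2 * (N + 1) + 1 ≠ 0)
  have := Finset.sum_congr rfl key
  rw [Finset.sum_sub_distrib, ← Finset.mul_sum, ← Finset.mul_sum,
    Finset.sum_range_sub'] at this
  rw [Finset.sum_range_succ, mul_add, mul_div_cancel₀ _ h3]
  simp only [Nat.sub_self, Nat.sub_zero] at this ⊢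
  linear_combination this

theorem halfBinom_convolution_odd_sq (N : ℕ) :
    (2 * ((N + 1 : ℕ) : K) + 1) *
        ∑ s ∈ Finset.range (N + 2), halfBinom K (N + 1 - s) / (2 * s + 1) ^ 2
      = 2 * ((N + 1 : ℕ) : K) *
          ∑ s ∈ Finset.range (N + 1), halfBinom K (N - s) / (2 * s + 1) ^ 2
        + ∑ s ∈ Finset.range (N + 2), halfBinom K (N + 1 - s) / (2 * s + 1)
        - ∑ s ∈ Finset.range (N + 1), halfBinom K (N - s) / (2 * s + 1) := by
  have key : ∀ s ∈ Finset.range (N + 1),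
      (2 * ((N + 1 : ℕ) : K) + 1) * (halfBinom K (N + 1 - s) / (2 * s + 1) ^ 2)
        - 2 * ((N + 1 : ℕ) : K) * (halfBinom K (N - s) / (2 * s + 1) ^ 2)
      = halfBinom K (N + 1 - s) / (2 * s + 1) - halfBinom K (N - s) / (2 * s + 1) := by
    intro s hs
    obtain ⟨k, rfl⟩ : ∃ k, N = k + s := ⟨N - s, by simp at hs; omega⟩
    have h1 : (2 * (s : K) + 1) ≠ 0 := by exact_mod_cast (by omega : 2 * s + 1 ≠ 0)
    have h2 : (k : K) + 1 ≠ 0 := by exact_mod_cast k.succ_ne_zero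
    rw [show k + s + 1 - s = k + 1 by omega, show k + s - s = k by omega, halfBinom_succ]
    push_cast
    field_simp
    ring
  have h3 : (2 * ((N + 1 : ℕ) : K) + 1) ≠ 0 := by
    exact_mod_cast (by omega : 2 * (N + 1) + 1 ≠ 0)
  have := Finset.sum_congr rfl key
  rw [Finset.sum_sub_distrib, Finset.sum_sub_distrib, ← Finset.mul_sum, ← Finset.mul_sum] at this
  rw [Finset.sum_range_succ, Finset.sum_range_succ (fun s : ℕ =>
    halfBinom K (N + 1 - s) / (2 * (s : K) + 1))]
  have h4 : (2 * ((N + 1 : ℕ) : K) + 1) *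
      (halfBinom K (N + 1 - (N + 1)) / (2 * ((N + 1 : ℕ) : K) + 1) ^ 2)
      = halfBinom K (N + 1 - (N + 1)) / (2 * ((N + 1 : ℕ) : K) + 1) := by
    field_simp
  linear_combination this + h4

theorem sum_halfBinom_convolution (N : ℕ) :
    (2 * N + 1) * halfBinom K N *
        ∑ s ∈ Finset.range (N + 1), halfBinom K (N - s) / (2 * s + 1)
      = halfBinomSqSum K N := by
  induction N with
  | zero => simp [halfBinomSqSum, halfBinom_zero]
  | succ N ih =>
    have h2 : (N : K) + 1 ≠ 0 := by exact_mod_cast N.succ_ne_zero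
    have h := halfBinom_convolution_odd (K := K) N
    rw [halfBinomSqSum_succ, ← ih]
    have h5 : 2 * ((N : K) + 1) * halfBinom K (N + 1) = halfBinom K N * (2 * N + 1) := by
      rw [halfBinom_succ]
      field_simp
    push_cast at h ⊢
    linear_combination halfBinom K (N + 1) * h +
      (∑ s ∈ Finset.range (N + 1), halfBinom K (N - s) / (2 * s + 1)) * h5

/-- Induction on N: the recurrence for the quadratic denominators feeds on the linear convolution,
already known as a sum of squares. Modulo p the bracket becomes a difference of harmonic numbers,
which is how A arises. -/
theorem sum_halfBinom_convolution_sq (N : ℕ) :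
    (2 * N + 1) * halfBinom K N *
        ∑ s ∈ Finset.range (N + 1), halfBinom K (N - s) / (2 * s + 1) ^ 2
      = ∑ k ∈ Finset.range (N + 1), halfBinom K k ^ 2 *
          (∑ j ∈ Finset.Ico k (N + 1), 1 / (2 * (j : K) + 1)
            - (harm K N - harm K k) / 2) := by
  induction N with
  | zero => simp [halfBinom_zero]
  | succ N ih =>
    have h2 : (N : K) + 1 ≠ 0 := by exact_mod_cast N.succ_ne_zero
    have h3 : (2 * ((N + 1 : ℕ) : K) + 1) ≠ 0 := by
      exact_mod_cast (by omega : 2 * (N + 1) + 1 ≠ 0)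
    have h := halfBinom_convolution_odd_sq (K := K) N
    have hU := sum_halfBinom_convolution (K := K) N
    have hU' := sum_halfBinom_convolution (K := K) (N + 1)
    have h5 : 2 * ((N : K) + 1) * halfBinom K (N + 1) = halfBinom K N * (2 * N + 1) := by
      rw [halfBinom_succ]
      field_simp
    have hterm : ∀ k ∈ Finset.range (N + 1), halfBinom K k ^ 2 *
          (∑ j ∈ Finset.Ico k (N + 1 + 1), 1 / (2 * (j : K) + 1)
            - (harm K (N + 1) - harm K k) / 2)
        = halfBinom K k ^ 2 * (∑ j ∈ Finset.Ico k (N + 1), 1 / (2 * (j : K) + 1)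
            - (harm K N - harm K k) / 2)
          + halfBinom K k ^ 2 *
            (1 / (2 * ((N + 1 : ℕ) : K) + 1) - 1 / (2 * ((N : K) + 1))) := by
      intro k hk
      rw [Finset.sum_Ico_succ_top (by simp at hk; omega), harm_succ]
      field_simp
      ring
    rw [Finset.sum_range_succ (fun k => halfBinom K k ^ 2 * _), Finset.sum_congr rfl hterm,
      Finset.sum_add_distrib, ← ih, ← Finset.sum_mul, ← halfBinomSqSum]
    rw [halfBinomSqSum_succ] at hU'
    simp only [Finset.sum_singleton, sub_self, zero_div, sub_zero,
      Nat.Ico_succ_singleton]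
    set Z := ∑ s ∈ Finset.range (N + 1), halfBinom K (N - s) / (2 * (s : K) + 1) ^ 2
    set U := ∑ s ∈ Finset.range (N + 1), halfBinom K (N - s) / (2 * (s : K) + 1)
    set U' := ∑ s ∈ Finset.range (N + 1 + 1), halfBinom K (N + 1 - s) / (2 * (s : K) + 1)
    have e1 : halfBinom K (N + 1) * U' = (halfBinomSqSum K N + halfBinom K (N + 1) ^ 2) /
        (2 * ((N + 1 : ℕ) : K) + 1) := by
      rw [eq_div_iff h3, ← hU']
      ring
    have e2 : halfBinom K (N + 1) * U = halfBinomSqSum K N / (2 * ((N : K) + 1)) := by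
      rw [eq_div_iff (by simpa using h2), ← hU]
      linear_combination U * h5
    push_cast at h e1 ⊢
    linear_combination halfBinom K (N + 1) * h + e1 - e2 + Z * h5

end Exact

/-! ### Calculus of congruences between p-adic numbers. -/

section Congruences

variable {p : ℕ} [Fact p.Prime]

theorem padicCongr_of_eq {k : ℕ} {x y z : ℚ_[p]} (hz : z ∈ PadicInt.subring p)
    (h : x - y = (p : ℚ_[p]) ^ k * z) : PadicCongr p k x y := ⟨⟨z, hz⟩, h⟩

namespace PadicCongr

variable {k : ℕ} {x y z x' y' : ℚ_[p]}

theorem exists_mem (h : PadicCongr p k x y) :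
    ∃ z ∈ PadicInt.subring p, x - y = (p : ℚ_[p]) ^ k * z := by
  obtain ⟨z, hz⟩ := h
  exact ⟨z, z.2, hz⟩

theorem refl (x : ℚ_[p]) : PadicCongr p k x x :=
  padicCongr_of_eq (zero_mem _) (by ring)

theorem of_eq (h : x = y) : PadicCongr p k x y := h ▸ refl x

theorem symm (h : PadicCongr p k x y) : PadicCongr p k y x := by
  obtain ⟨z, hz, e⟩ := h.exists_mem
  exact padicCongr_of_eq (neg_mem hz) (by linear_combination -e)

theorem trans (h : PadicCongr p k x y) (h' : PadicCongr p k y z) : PadicCongr p k x z := by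
  obtain ⟨a, ha, e⟩ := h.exists_mem
  obtain ⟨b, hb, e'⟩ := h'.exists_mem
  exact padicCongr_of_eq (add_mem ha hb) (by linear_combination e + e')

theorem add (h : PadicCongr p k x y) (h' : PadicCongr p k x' y') :
    PadicCongr p k (x + x') (y + y') := by
  obtain ⟨a, ha, e⟩ := h.exists_mem
  obtain ⟨b, hb, e'⟩ := h'.exists_mem
  exact padicCongr_of_eq (add_mem ha hb) (by linear_combination e + e')

theorem neg (h : PadicCongr p k x y) : PadicCongr p k (-x) (-y) := by
  obtain ⟨z, hz, e⟩ := h.exists_mem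
  exact padicCongr_of_eq (neg_mem hz) (by linear_combination -e)

theorem sub (h : PadicCongr p k x y) (h' : PadicCongr p k x' y') :
    PadicCongr p k (x - x') (y - y') := by
  simpa [sub_eq_add_neg] using h.add h'.neg

theorem mul_left {c : ℚ_[p]} (hc : c ∈ PadicInt.subring p) (h : PadicCongr p k x y) :
    PadicCongr p k (c * x) (c * y) := by
  obtain ⟨z, hz, e⟩ := h.exists_mem
  exact padicCongr_of_eq (mul_mem hc hz) (by linear_combination c * e)

theorem mem_iff (h : PadicCongr p k x y) :
    x ∈ PadicInt.subring p ↔ y ∈ PadicInt.subring p := by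
  obtain ⟨z, hz, e⟩ := h.exists_mem
  have hd : (p : ℚ_[p]) ^ k * z ∈ PadicInt.subring p := mul_mem (pow_mem (natCast_mem _ p) k) hz
  constructor
  · intro hx
    rw [show y = x - (p : ℚ_[p]) ^ k * z by linear_combination -e]
    exact sub_mem hx hd
  · intro hy
    rw [show x = y + (p : ℚ_[p]) ^ k * z by linear_combination e]
    exact add_mem hy hd

theorem mul (hx : x ∈ PadicInt.subring p) (hx' : x' ∈ PadicInt.subring p)
    (h : PadicCongr p k x y) (h' : PadicCongr p k x' y') : PadicCongr p k (x * x') (y * y') := by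
  have h1 := h'.mul_left hx
  have h2 := h.mul_left (h'.mem_iff.1 hx')
  rw [mul_comm y' x, mul_comm y' y] at h2
  exact h1.trans h2

theorem pow (hx : x ∈ PadicInt.subring p) (h : PadicCongr p k x y) (l : ℕ) :
    PadicCongr p k (x ^ l) (y ^ l) := by
  induction l with
  | zero => simpa using refl 1
  | succ l ih =>
    rw [pow_succ, pow_succ]
    exact mul (pow_mem hx l) hx ih h

theorem sum {ι : Type*} (s : Finset ι) {f g : ι → ℚ_[p]}
    (h : ∀ i ∈ s, PadicCongr p k (f i) (g i)) :
    PadicCongr p k (∑ i ∈ s, f i) (∑ i ∈ s, g i) := by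
  classical
  induction s using Finset.induction_on with
  | empty => simpa using refl 0
  | insert a s ha ih =>
    rw [Finset.sum_insert ha, Finset.sum_insert ha]
    exact (h a (by simp)).add (ih fun i hi => h i (by simp [hi]))

theorem prod {ι : Type*} (s : Finset ι) {f g : ι → ℚ_[p]}
    (hf : ∀ i ∈ s, f i ∈ PadicInt.subring p) (h : ∀ i ∈ s, PadicCongr p k (f i) (g i)) :
    PadicCongr p k (∏ i ∈ s, f i) (∏ i ∈ s, g i) := by
  classical
  induction s using Finset.induction_on with
  | empty => simpa using refl 1
  | insert a s ha ih =>
    rw [Finset.prod_insert ha, Finset.prod_insert ha]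
    exact mul (hf a (by simp)) (prod_mem fun i hi => hf i (by simp [hi])) (h a (by simp))
      (ih (fun i hi => hf i (by simp [hi])) fun i hi => h i (by simp [hi]))

theorem mono {l : ℕ} (hl : l ≤ k) (h : PadicCongr p k x y) : PadicCongr p l x y := by
  obtain ⟨z, hz, e⟩ := h.exists_mem
  refine padicCongr_of_eq (mul_mem (pow_mem (natCast_mem _ p) (k - l)) hz) ?_
  rw [e, ← mul_assoc, ← pow_add, Nat.add_sub_cancel' hl]

theorem pow_mul (l : ℕ) (h : PadicCongr p k x y) :
    PadicCongr p (l + k) ((p : ℚ_[p]) ^ l * x) ((p : ℚ_[p]) ^ l * y) := by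
  obtain ⟨z, hz, e⟩ := h.exists_mem
  refine padicCongr_of_eq hz ?_
  rw [pow_add]
  linear_combination (p : ℚ_[p]) ^ l * e

theorem p_mul (h : PadicCongr p 1 x y) : PadicCongr p 2 ((p : ℚ_[p]) * x) (p * y) := by
  simpa using h.pow_mul 1

theorem cancel {c : ℚ_[p]} (hc0 : c ≠ 0) (hc : c⁻¹ ∈ PadicInt.subring p)
    (h : PadicCongr p k (c * x) (c * y)) : PadicCongr p k x y := by
  simpa [inv_mul_cancel_left₀ hc0] using h.mul_left hc

end PadicCongr

theorem inv_natCast_mem_subring {a : ℕ} (h : p.Coprime a) :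
    (a : ℚ_[p])⁻¹ ∈ PadicInt.subring p := by
  have : ‖(a : ℚ_[p])‖ = 1 := (Padic.norm_natCast_eq_one_iff).2 h
  simp [PadicInt.subring, this]

theorem inv_natCast_mem_of_lt {a : ℕ} (h0 : 0 < a) (h : a < p) :
    (a : ℚ_[p])⁻¹ ∈ PadicInt.subring p :=
  inv_natCast_mem_subring (((Fact.out : p.Prime).coprime_iff_not_dvd).2
    fun hd => absurd (Nat.le_of_dvd h0 hd) (by omega))

theorem inv_factorial_mem {a : ℕ} (h : a < p) :
    (a.factorial : ℚ_[p])⁻¹ ∈ PadicInt.subring p :=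
  inv_natCast_mem_subring (((Fact.out : p.Prime).coprime_iff_not_dvd).2
    fun hd => absurd (((Fact.out : p.Prime).dvd_factorial).1 hd) (by omega))

theorem inv_two_mem (hp : p ≠ 2) : (2 : ℚ_[p])⁻¹ ∈ PadicInt.subring p := by
  exact_mod_cast inv_natCast_mem_subring (a := 2)
    ((Nat.coprime_primes Fact.out Nat.prime_two).2 hp)

theorem inv_four_mem (hp2 : p ≠ 2) : (4 : ℚ_[p])⁻¹ ∈ PadicInt.subring p := by
  rw [show (4 : ℚ_[p]) = 2 * 2 by norm_num, mul_inv]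
  exact mul_mem (inv_two_mem hp2) (inv_two_mem hp2)

theorem harm_mem {N : ℕ} (h : N < p) : harm ℚ_[p] N ∈ PadicInt.subring p := by
  refine sum_mem fun i hi => ?_
  rw [one_div]
  exact_mod_cast inv_natCast_mem_of_lt (p := p) (Nat.succ_pos i)
    (by simp at hi; omega)

theorem halfBinom_mem (hp : p ≠ 2) (k : ℕ) : halfBinom ℚ_[p] k ∈ PadicInt.subring p := by
  rw [halfBinom, div_eq_mul_inv, ← inv_pow, show (4 : ℚ_[p]) = 2 * 2 by norm_num, mul_inv]
  exact mul_mem (natCast_mem _ _) (pow_mem (mul_mem (inv_two_mem hp) (inv_two_mem hp)) _)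

theorem prod_one_add_p_mul {ι : Type*} (s : Finset ι) {a : ι → ℚ_[p]}
    (ha : ∀ i ∈ s, a i ∈ PadicInt.subring p) :
    PadicCongr p 2 (∏ i ∈ s, (1 + p * a i)) (1 + p * ∑ i ∈ s, a i) := by
  classical
  induction s using Finset.induction_on with
  | empty => simpa using PadicCongr.refl 1
  | insert b s hb ih =>
    have hs : ∀ i ∈ s, a i ∈ PadicInt.subring p := fun i hi => ha i (by simp [hi])
    have hb' := ha b (by simp)
    rw [Finset.prod_insert hb, Finset.sum_insert hb]
    refine ((ih hs).mul_left (add_mem (one_mem _) (mul_mem (natCast_mem _ p) hb'))).trans ?_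
    exact padicCongr_of_eq (mul_mem hb' (sum_mem hs)) (by ring)

end Congruences

/-! ### J_n modulo p^2. -/

section Middle

variable {p n : ℕ} [Fact p.Prime]

theorem harm_sub_harm {N k : ℕ} (h : k ≤ N) {K : Type*} [Field K] :
    ∑ j ∈ Finset.range k, 1 / ((N - j : ℕ) : K) = harm K N - harm K (N - k) := by
  induction k with
  | zero => simp
  | succ k ih =>
    obtain ⟨d, rfl⟩ : ∃ d, N = d + k + 1 := ⟨N - k - 1, by omega⟩
    rw [Finset.sum_range_succ, ih (by omega), show d + k + 1 - k = d + 1 by omega,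
      show d + k + 1 - (k + 1) = d by omega, harm_succ d]
    push_cast
    ring

/-- Exact, since 2j+1 = p - 2(m-j): each factor of h_k is the corresponding factor of (-1)^k C(m,k)
times 1 - p/(2(m-j)). -/
theorem halfBinom_eq_choose_mul (hp : p = 4 * n + 3) {k : ℕ} (hk : k ≤ 2 * n + 1) :
    halfBinom ℚ_[p] k = (-1) ^ k * ((2 * n + 1).choose k : ℚ_[p]) *
      ∏ j ∈ Finset.range k, (1 + (p : ℚ_[p]) * (-(1 / 2) * (1 / ((2 * n + 1 - j : ℕ) : ℚ_[p])))) := by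
  have hpc : (p : ℚ_[p]) = 4 * n + 3 := by exact_mod_cast congrArg (Nat.cast (R := ℚ_[p])) hp
  induction k with
  | zero => simp [halfBinom_zero]
  | succ k ih =>
    obtain ⟨d, hd⟩ : ∃ d, 2 * n + 1 = d + k + 1 := ⟨2 * n - k, by omega⟩
    have hc : ((2 * n + 1).choose (k + 1) : ℚ_[p]) * (k + 1)
        = (2 * n + 1).choose k * ((d : ℚ_[p]) + 1) := by
      have := Nat.choose_succ_right_eq (2 * n + 1) k
      rw [show 2 * n + 1 - k = d + 1 by omega] at this
      exact_mod_cast this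
    have hdc : 2 * (n : ℚ_[p]) = d + k := by
      have : 2 * n = d + k := by omega
      exact_mod_cast this
    have h1 : (k : ℚ_[p]) + 1 ≠ 0 := by exact_mod_cast k.succ_ne_zero
    have h2 : (d : ℚ_[p]) + 1 ≠ 0 := by exact_mod_cast d.succ_ne_zero
    rw [halfBinom_succ, ih (by omega), Finset.prod_range_succ, show 2 * n + 1 - k = d + 1 by omega,
      eq_div_of_mul_eq h1 hc]
    generalize ∏ j ∈ Finset.range k,
      (1 + (p : ℚ_[p]) * (-(1 / 2) * (1 / ((2 * n + 1 - j : ℕ) : ℚ_[p])))) = Q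
    rw [hpc]
    push_cast
    field_simp
    rw [show (4 : ℚ_[p]) * n = 2 * (d + k) by rw [← hdc]; ring]
    ring

theorem halfBinom_congr (hp : p = 4 * n + 3) {k : ℕ} (hk : k ≤ 2 * n + 1) :
    PadicCongr p 2 (halfBinom ℚ_[p] k) ((-1) ^ k * ((2 * n + 1).choose k : ℚ_[p]) *
      (1 - p / 2 * (harm ℚ_[p] (2 * n + 1) - harm ℚ_[p] (2 * n + 1 - k)))) := by
  have hp2 : p ≠ 2 := by omega
  rw [halfBinom_eq_choose_mul hp hk]
  refine PadicCongr.mul_left (mul_mem (pow_mem (neg_mem (one_mem _)) _) (natCast_mem _ _)) ?_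
  refine (prod_one_add_p_mul _ fun j hj => ?_).trans (PadicCongr.of_eq ?_)
  · rw [one_div, one_div]
    exact mul_mem (neg_mem (inv_two_mem hp2))
      (inv_natCast_mem_of_lt (by simp at hj; omega) (by omega))
  · rw [← Finset.mul_sum, harm_sub_harm hk]
    ring

theorem halfBinom_congr_choose (hp : p = 4 * n + 3) {k : ℕ} (hk : k ≤ 2 * n + 1) :
    PadicCongr p 1 (halfBinom ℚ_[p] k) ((-1) ^ k * ((2 * n + 1).choose k : ℚ_[p])) := by
  refine ((halfBinom_congr hp hk).mono one_le_two).trans ?_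
  refine padicCongr_of_eq (z := -((-1) ^ k * ((2 * n + 1).choose k : ℚ_[p]) * (2⁻¹ *
    (harm ℚ_[p] (2 * n + 1) - harm ℚ_[p] (2 * n + 1 - k))))) ?_ (by ring)
  exact neg_mem (mul_mem (mul_mem (pow_mem (neg_mem (one_mem _)) _) (natCast_mem _ _))
    (mul_mem (inv_two_mem (by omega)) (sub_mem (harm_mem (by omega)) (harm_mem (by omega)))))

theorem halfBinom_sq_congr_choose (hp : p = 4 * n + 3) {k : ℕ} (hk : k ≤ 2 * n + 1) :
    PadicCongr p 1 (halfBinom ℚ_[p] k ^ 2) (((2 * n + 1).choose k : ℚ_[p]) ^ 2) := by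
  refine ((halfBinom_congr_choose hp hk).pow (halfBinom_mem (by omega) k) 2).trans
    (PadicCongr.of_eq ?_)
  rw [mul_pow, ← pow_mul, mul_comm k 2, pow_mul]
  norm_num

theorem halfBinom_sq_congr (hp : p = 4 * n + 3) {k : ℕ} (hk : k ≤ 2 * n + 1) :
    PadicCongr p 2 (halfBinom ℚ_[p] k ^ 2) (((2 * n + 1).choose k : ℚ_[p]) ^ 2 *
      (1 - p * (harm ℚ_[p] (2 * n + 1) - harm ℚ_[p] (2 * n + 1 - k)))) := by
  have hi := inv_two_mem (p := p) (by omega)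
  refine ((halfBinom_congr hp hk).pow (halfBinom_mem (by omega) k) 2).trans ?_
  have hs : (((-1 : ℚ_[p]) ^ k) ^ 2) = 1 := by
    rw [← pow_mul, mul_comm k 2, pow_mul]; norm_num
  refine padicCongr_of_eq (z := ((2 * n + 1).choose k : ℚ_[p]) ^ 2 *
    (2⁻¹ * (harm ℚ_[p] (2 * n + 1) - harm ℚ_[p] (2 * n + 1 - k))) ^ 2) ?_ ?_
  · exact mul_mem (pow_mem (natCast_mem _ _) _) (pow_mem (mul_mem hi
      (sub_mem (harm_mem (by omega)) (harm_mem (by omega)))) _)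
  · rw [mul_pow, mul_pow, hs]
    ring

/-- `((1/2)_k / k!)^2` as a product. -/
theorem halfBinom_sq_eq_prod {K : Type*} [Field K] [CharZero K] (k : ℕ) :
    halfBinom K k ^ 2
      = ∏ j ∈ Finset.range k, ((2 * (j : K) + 1) ^ 2 / 4 / ((j : K) + 1) ^ 2) := by
  induction k with
  | zero => simp [halfBinom_zero]
  | succ k ih =>
    have h1 : (k : K) + 1 ≠ 0 := by exact_mod_cast k.succ_ne_zero
    rw [Finset.prod_range_succ, ← ih, halfBinom_succ]
    field_simp
    ring

/-- Factor by factor, (j-m)(j+m+1) = (j+1/2)^2 - p^2/4: the error has no linear term in p. -/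
theorem halfBinom_sq_congr_legendreCoeff (hp : p = 4 * n + 3) {k : ℕ} (hk : k ≤ 2 * n + 1) :
    PadicCongr p 2 (halfBinom ℚ_[p] k ^ 2) (legendreCoeff ((2 * n + 1 : ℕ) : ℚ_[p]) k) := by
  have hpc : (p : ℚ_[p]) = 4 * n + 3 := by exact_mod_cast congrArg (Nat.cast (R := ℚ_[p])) hp
  have hi := inv_two_mem (p := p) (by omega)
  have hi4 : (4 : ℚ_[p])⁻¹ ∈ PadicInt.subring p := by
    rw [show (4 : ℚ_[p]) = 2 * 2 by norm_num, mul_inv]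
    exact mul_mem hi hi
  have hinv {j : ℕ} (hj : j ∈ Finset.range k) : ((j : ℚ_[p]) + 1)⁻¹ ∈ PadicInt.subring p := by
    have := inv_natCast_mem_of_lt (p := p) (Nat.succ_pos j) (by simp at hj; omega)
    exact_mod_cast this
  rw [halfBinom_sq_eq_prod]
  refine PadicCongr.prod _ (fun j hj => ?_) fun j hj => ?_
  · rw [div_eq_mul_inv, div_eq_mul_inv, ← inv_pow]
    refine mul_mem (mul_mem (pow_mem ?_ _) hi4) (pow_mem (hinv hj) _)
    exact_mod_cast natCast_mem (PadicInt.subring p) (2 * j + 1)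
  · refine padicCongr_of_eq (z := 4⁻¹ * ((j : ℚ_[p]) + 1)⁻¹ ^ 2)
      (mul_mem hi4 (pow_mem (hinv hj) _)) ?_
    have h1 : (j : ℚ_[p]) + 1 ≠ 0 := by exact_mod_cast j.succ_ne_zero
    rw [hpc]
    push_cast
    field_simp
    ring

theorem sum_halfBinom_sq_congr (hp : p = 4 * n + 3) :
    PadicCongr p 2 (∑ k ∈ Finset.range (2 * n + 2), halfBinom ℚ_[p] k ^ 2) (-1) := by
  refine (PadicCongr.sum _ fun k hk =>
    halfBinom_sq_congr_legendreCoeff hp (by simp at hk; omega)).trans (PadicCongr.of_eq ?_)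
  rw [sum_legendreCoeff]
  exact Odd.neg_one_pow ⟨n, rfl⟩

/-- The first-order defect of `∑_{k ≤ n} ((1/2)_k / k!)^2`. -/
def harmDefect (K : Type*) [Field K] (n : ℕ) : K :=
  ∑ k ∈ Finset.range (n + 1), halfBinom K k ^ 2 * (harm K (2 * n + 1 - k) - harm K k)

theorem harmDefect_mem (hp : p = 4 * n + 3) : harmDefect ℚ_[p] n ∈ PadicInt.subring p :=
  sum_mem fun k hk => mul_mem (pow_mem (halfBinom_mem (by omega) k) _)
    (sub_mem (harm_mem (by omega)) (harm_mem (by simp at hk; omega)))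

/-- C(m,k) is symmetric, so h_k^2 and h_{m-k}^2 differ only in their first-order harmonic
corrections. -/
theorem halfBinom_sq_sub_reflect (hp : p = 4 * n + 3) {k : ℕ} (hk : k ≤ n) :
    PadicCongr p 2 (halfBinom ℚ_[p] k ^ 2 - halfBinom ℚ_[p] (2 * n + 1 - k) ^ 2)
      (p * (halfBinom ℚ_[p] k ^ 2 * (harm ℚ_[p] (2 * n + 1 - k) - harm ℚ_[p] k))) := by
  have h1 := halfBinom_sq_congr hp (show k ≤ 2 * n + 1 by omega)
  have h2 := halfBinom_sq_congr hp (show 2 * n + 1 - k ≤ 2 * n + 1 by omega)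
  rw [Nat.choose_symm (by omega), show 2 * n + 1 - (2 * n + 1 - k) = k by omega] at h2
  refine (h1.sub h2).trans ?_
  have h3 := ((halfBinom_sq_congr_choose hp (show k ≤ 2 * n + 1 by omega)).mul_left
    (sub_mem (harm_mem (p := p) (show 2 * n + 1 - k < p by omega))
      (harm_mem (p := p) (show k < p by omega)))).symm.p_mul
  refine (PadicCongr.of_eq ?_).trans (h3.trans (PadicCongr.of_eq ?_)) <;> ring

theorem sum_range_reflect_halves {K : Type*} [AddCommMonoid K] (f : ℕ → K) (n : ℕ) :
    ∑ k ∈ Finset.range (2 * n + 2), f k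
      = ∑ k ∈ Finset.range (n + 1), f k + ∑ k ∈ Finset.range (n + 1), f (2 * n + 1 - k) := by
  rw [show 2 * n + 2 = (n + 1) + (n + 1) by ring, Finset.sum_range_add]
  congr 1
  rw [← Finset.sum_range_reflect]
  refine Finset.sum_congr rfl fun k hk => ?_
  congr 1
  simp at hk
  omega

/-- Twice the lower half is the full sum, -1 modulo p^2, plus the sum of the reflection differences.
-/
theorem halfBinomSqSum_congr (hp : p = 4 * n + 3) :
    PadicCongr p 2 (2 * halfBinomSqSum ℚ_[p] n) (-1 + p * harmDefect ℚ_[p] n) := by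
  have h1 := sum_halfBinom_sq_congr hp
  rw [sum_range_reflect_halves] at h1
  have h2 := PadicCongr.sum (Finset.range (n + 1)) fun k hk =>
    halfBinom_sq_sub_reflect hp (show k ≤ n by simp at hk; omega)
  rw [← Finset.mul_sum, Finset.sum_sub_distrib] at h2
  refine (PadicCongr.of_eq ?_).trans (h1.add h2)
  rw [halfBinomSqSum]
  ring

end Middle

/-! ### Two specialisations of the interpolation formula. -/

section Exact

variable {K : Type*} [Field K] [CharZero K]

theorem prod_add_half (N : ℕ) :
    ∏ l ∈ Finset.range N, ((l : K) + 1 / 2) = N.factorial * halfBinom K N := by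
  induction N with
  | zero => simp [halfBinom_zero]
  | succ N ih =>
    have h1 : (N : K) + 1 ≠ 0 := by exact_mod_cast N.succ_ne_zero
    rw [Finset.prod_range_succ, ih, halfBinom_succ, Nat.factorial_succ]
    push_cast
    field_simp

theorem halfBinom_sq_eq_legendreCoeff (k : ℕ) :
    halfBinom K k ^ 2 = legendreCoeff (-(1 / 2) : K) k := by
  rw [halfBinom_sq_eq_prod, legendreCoeff]
  refine Finset.prod_congr rfl fun j _ => ?_
  have h1 : (j : K) + 1 ≠ 0 := by exact_mod_cast j.succ_ne_zero
  field_simp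
  ring

/-- The case μ = -1/2, y = 1/2, where y = 1-y makes every `reflRatio` equal to 1. -/
theorem sum_halfBinom_sq_div_odd (n : ℕ) :
    ∑ k ∈ Finset.range (n + 1), halfBinom K k ^ 2 / (2 * k + 1)
      = (2 * n + 1) ^ 2 * halfBinom K n ^ 2 * (n.factorial : K) ^ 2 *
        ∑ s ∈ Finset.range (n + 1), (-1) ^ s / ((n - s).factorial * (n + 1 + s).factorial : K)
          / (2 * s + 1) ^ 2 := by
  have hodd (i : ℕ) : 2 * (i : K) + 1 ≠ 0 := by exact_mod_cast (by omega : 2 * i + 1 ≠ 0)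
  have hy (i : ℕ) : (1 / 2 : K) + i ≠ 0 := by
    have := hodd i
    intro h
    exact this (by linear_combination 2 * h)
  have hμ (s : ℕ) : (-(1 / 2) - (s : K)) * (-(1 / 2) + s + 1) ≠ 0 := by
    have : (-(1 / 2) - (s : K)) * (-(1 / 2) + s + 1) = -((1 / 2 + s) * (1 / 2 + s)) := by ring
    rw [this]
    exact neg_ne_zero.2 (mul_ne_zero (hy s) (hy s))
  have hr (s : ℕ) : reflRatio (1 / 2 : K) s = 1 := by
    refine Finset.prod_eq_one fun i _ => ?_
    rw [show (i : K) + 1 - 1 / 2 = 1 / 2 + i by ring, div_self (hy i)]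
  have h := sum_legendreCoeff_div_add hy hμ n
  have hP : ∏ l ∈ Finset.range (n + 1), ((-(1 / 2) - (l : K)) * (-(1 / 2) + l + 1))
      = (-1) ^ (n + 1) * ((2 * n + 1) / 2 * halfBinom K n * n.factorial) ^ 2 := by
    have h1 := prod_add_half (K := K) n
    have e : ∀ l ∈ Finset.range (n + 1), (-(1 / 2) - (l : K)) * (-(1 / 2) + l + 1)
        = -1 * ((l : K) + 1 / 2) ^ 2 := fun l _ => by ring
    rw [Finset.prod_congr rfl e, Finset.prod_mul_distrib, Finset.prod_pow,
      Finset.prod_range_succ (fun l : ℕ => (l : K) + 1 / 2), h1]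
    simp
    ring
  rw [hP] at h
  have e1 : ∑ k ∈ Finset.range (n + 1), halfBinom K k ^ 2 / (2 * k + 1)
      = 1 / 2 * ∑ k ∈ Finset.range (n + 1), legendreCoeff (-(1 / 2) : K) k / (1 / 2 + k) := by
    rw [Finset.mul_sum]
    refine Finset.sum_congr rfl fun k _ => ?_
    rw [halfBinom_sq_eq_legendreCoeff, show 2 * (k : K) + 1 = 2 * (1 / 2 + k) by ring]
    have := hy k
    field_simp
  have e2 : ∀ s ∈ Finset.range (n + 1), (-1 : K) ^ s * (2 * s + 1) *
      (reflRatio (1 / 2) s / (1 / 2 + s)) / ((n - s).factorial * (n + 1 + s).factorial) /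
        ((-(1 / 2) - s) * (-(1 / 2) + s + 1))
      = -8 * ((-1) ^ s / ((n - s).factorial * (n + 1 + s).factorial : K)
          / (2 * s + 1) ^ 2) := by
    intro s _
    have h1 : ((n - s).factorial : K) ≠ 0 := by exact_mod_cast Nat.factorial_ne_zero _
    have h2 : ((n + 1 + s).factorial : K) ≠ 0 := by exact_mod_cast Nat.factorial_ne_zero _
    rw [hr, show (1 / 2 : K) + s = (2 * s + 1) / 2 by ring,
      show (-(1 / 2) - (s : K)) * (-(1 / 2) + s + 1) = -((2 * s + 1) ^ 2 / 4) by ring]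
    have := hodd s
    field_simp
    norm_num
  rw [Finset.sum_congr rfl e2, ← Finset.mul_sum] at h
  rw [e1, h, pow_succ]
  have hs : ((-1 : K) ^ n) * (-1) ^ n = 1 := by rw [← mul_pow]; norm_num
  linear_combination ((2 * n + 1) ^ 2 * halfBinom K n ^ 2 * (n.factorial : K) ^ 2 *
        ∑ s ∈ Finset.range (n + 1), (-1) ^ s / ((n - s).factorial * (n + 1 + s).factorial : K)
          / (2 * s + 1) ^ 2) * hs

theorem reflRatio_natCast {n s : ℕ} (h : s ≤ n) :
    reflRatio ((n : K) + 1) s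
      = (-1) ^ s * (n.factorial : K) ^ 2 / ((n - s).factorial * (n + s).factorial) := by
  have hf (k : ℕ) : (k.factorial : K) ≠ 0 := by exact_mod_cast Nat.factorial_ne_zero _
  induction s with
  | zero =>
    have := hf n
    simp [reflRatio]
    field_simp
  | succ s ih =>
    obtain ⟨d, rfl⟩ : ∃ d, n = d + s + 1 := ⟨n - s - 1, by omega⟩
    rw [reflRatio_succ, ih (by omega), show d + s + 1 - s = d + 1 by omega,
      show d + s + 1 - (s + 1) = d by omega, ← add_assoc (d + s + 1) s 1, Nat.factorial_succ d,
      Nat.factorial_succ (d + s + 1 + s)]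
    have := hf d
    have := hf (d + s + 1 + s)
    have h1 : (d : K) + 1 ≠ 0 := by exact_mod_cast d.succ_ne_zero
    have h2 : (d : K) + s + 1 + s + 1 ≠ 0 := by exact_mod_cast (d + s + 1 + s).succ_ne_zero
    push_cast
    rw [show (d : K) + s + 1 + 1 + s = d + s + 1 + s + 1 by ring]
    field_simp
    ring

theorem prod_half_integers (n : ℕ) :
    ∏ l ∈ Finset.range (n + 1), (((n : K) + 1 / 2 - l) * (n + 1 / 2 + l + 1))
      = (4 * n + 3) / 2 * (2 * n + 1).factorial * halfBinom K (2 * n + 1) := by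
  have h := prod_add_half (K := K) (2 * n + 2)
  have h0 : (4 * n + 3) / 2 * (2 * n + 1).factorial * halfBinom K (2 * n + 1)
      = (2 * n + 2).factorial * halfBinom K (2 * n + 2) := by
    have h1 : (n : K) + 1 ≠ 0 := by exact_mod_cast n.succ_ne_zero
    rw [halfBinom_succ (2 * n + 1), Nat.factorial_succ (2 * n + 1)]
    push_cast
    rw [show 2 * (2 * (n : K) + 1 + 1) = 4 * (n + 1) by ring]
    field_simp
    ring
  rw [show 2 * n + 2 = (n + 1) + (n + 1) by ring, Finset.prod_range_add,
    ← Finset.prod_range_reflect (fun l : ℕ => (l : K) + 1 / 2) (n + 1),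
    show (n + 1) + (n + 1) = 2 * n + 2 by ring] at h
  rw [h0, ← h, Finset.prod_mul_distrib]
  congr 1
  · refine Finset.prod_congr rfl fun l hl => ?_
    rw [show n + 1 - 1 - l = n - l by omega, Nat.cast_sub (by simp at hl; omega)]
    ring
  · refine Finset.prod_congr rfl fun l _ => ?_
    push_cast
    ring

/-- The case μ = n+1/2, y = n+1. With k = n-s the factorials form C(2n+1,k)^2, and 1/((μ-s)(μ+s+1))
splits into partial fractions. -/
theorem sum_legendreCoeff_quarter (n : ℕ) :
    ∑ k ∈ Finset.range (n + 1), legendreCoeff ((n : K) + 1 / 2) k / (n + 1 + k)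
      = (-1) ^ n * halfBinom K (2 * n + 1) * (n.factorial : K) ^ 2 / (2 * n + 1).factorial *
        ((4 * n + 3) * ∑ k ∈ Finset.range (n + 1), ((2 * n + 1).choose k : K) ^ 2 *
          (1 / (2 * k + 1) - 1 / (4 * n + 3 - 2 * k))) := by
  have hf (k : ℕ) : (k.factorial : K) ≠ 0 := by exact_mod_cast Nat.factorial_ne_zero _
  have hy (i : ℕ) : (n : K) + 1 + i ≠ 0 := by exact_mod_cast (by omega : n + 1 + i ≠ 0)
  have hμ (s : ℕ) : ((n : K) + 1 / 2 - s) * (n + 1 / 2 + s + 1) ≠ 0 := by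
    refine mul_ne_zero (fun h => ?_) (fun h => ?_)
    · have : 2 * (n : K) + 1 = 2 * s := by linear_combination 2 * h
      have : 2 * n + 1 = 2 * s := by exact_mod_cast this
      omega
    · have : 2 * (n : K) + 2 * s + 3 = 0 := by linear_combination 2 * h
      have : 2 * n + 2 * s + 3 = 0 := by exact_mod_cast this
      omega
  rw [sum_legendreCoeff_div_add hy hμ n, prod_half_integers,
    ← Finset.sum_range_reflect (fun k : ℕ => ((2 * n + 1).choose k : K) ^ 2 *
          (1 / (2 * (k : K) + 1) - 1 / (4 * n + 3 - 2 * k))), Finset.mul_sum, Finset.mul_sum,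
    Finset.mul_sum]
  refine Finset.sum_congr rfl fun s hs => ?_
  obtain ⟨d, rfl⟩ : ∃ d, n = d + s := ⟨n - s, by simp at hs; omega⟩
  rw [reflRatio_natCast (by omega), show d + s - s = d by omega,
    show d + s + 1 - 1 - s = d by omega]
  have hc : ((2 * (d + s) + 1).choose d : K)
      = (2 * (d + s) + 1).factorial / (d.factorial * (d + s + 1 + s).factorial) := by
    rw [Nat.cast_choose K (by omega), show 2 * (d + s) + 1 - d = d + s + 1 + s by omega]
  have e1 : ((d + s + 1 + s).factorial : K) = (d + s + 1 + s) * (d + s + s).factorial := by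
    rw [show d + s + 1 + s = (d + s + s) + 1 by ring, Nat.factorial_succ]
    push_cast
    ring
  rw [hc, e1]
  have h1 := hf d
  have h2 := hf (d + s + s)
  have h3 := hf (2 * (d + s) + 1)
  have h4 := hy s
  have h5 := hμ s
  push_cast at h4 h5 ⊢
  have h6 : 2 * (d : K) + 1 ≠ 0 := by exact_mod_cast (by omega : 2 * d + 1 ≠ 0)
  have h7 : 2 * (d : K) + 4 * s + 3 ≠ 0 := by exact_mod_cast (by omega : 2 * d + 4 * s + 3 ≠ 0)
  have hs1 : ((-1 : K) ^ s) ^ 2 = 1 := by rw [← pow_mul, mul_comm, pow_mul]; norm_num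
  rw [show 4 * ((d : K) + s) + 3 - 2 * d = 2 * d + 4 * s + 3 by ring,
    show ((d : K) + s + 1 / 2 - s) * (d + s + 1 / 2 + s + 1)
      = (2 * d + 1) * (2 * d + 4 * s + 3) / 4 by ring,
    show 1 / (2 * (d : K) + 1) - 1 / (2 * d + 4 * s + 3)
      = (4 * s + 2) / ((2 * d + 1) * (2 * d + 4 * s + 3)) by
      rw [div_sub_div _ _ h6 h7]
      ring]
  generalize 2 * (d : K) + 1 = x at h6 ⊢
  generalize 2 * (d : K) + 4 * s + 3 = y at h7 ⊢
  field_simp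
  rw [hs1]
  ring

end Exact

/-! ### The sum of h_k^2/(2k+1) modulo p. -/

section Middle

variable {p n : ℕ} [Fact p.Prime]

theorem inv_mem_of_eq_natCast {x : ℚ_[p]} {a : ℕ} (h : x = a) (h0 : 0 < a) (ha : a < p) :
    x⁻¹ ∈ PadicInt.subring p := h ▸ inv_natCast_mem_of_lt h0 ha

theorem one_div_odd_congr (hp : p = 4 * n + 3) {j : ℕ} (hj : j ≤ n) :
    PadicCongr p 1 (1 / (2 * (j : ℚ_[p]) + 1)) (-(1 / 2) * (1 / ((2 * n + 1 - j : ℕ) : ℚ_[p]))) := by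
  have hpc : (p : ℚ_[p]) = 4 * n + 3 := by exact_mod_cast congrArg (Nat.cast (R := ℚ_[p])) hp
  have h1 : (2 * (j : ℚ_[p]) + 1) ≠ 0 := by exact_mod_cast (by omega : 2 * j + 1 ≠ 0)
  have h2 : ((2 * n + 1 - j : ℕ) : ℚ_[p]) ≠ 0 := by exact_mod_cast (by omega : 2 * n + 1 - j ≠ 0)
  refine padicCongr_of_eq (z := 2⁻¹ * (2 * (j : ℚ_[p]) + 1)⁻¹ * ((2 * n + 1 - j : ℕ) : ℚ_[p])⁻¹)
    (mul_mem (mul_mem (inv_two_mem (by omega)) (inv_mem_of_eq_natCast (a := 2 * j + 1)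
      (by push_cast; ring) (by omega) (by omega))) (inv_natCast_mem_of_lt (by omega) (by omega))) ?_
  rw [hpc]
  rw [Nat.cast_sub (by omega)] at h2 ⊢
  push_cast at h2 ⊢
  field_simp
  ring

/-- The exact alternating formula has weights C(m,n-s), congruent to (-1)^(n-s) h_{n-s}; it thus
becomes the quadratic convolution, whose harmonic evaluation gives A. -/
theorem sum_halfBinom_sq_div_odd_congr (hp : p = 4 * n + 3) :
    PadicCongr p 1 (∑ k ∈ Finset.range (n + 1), halfBinom ℚ_[p] k ^ 2 / (2 * k + 1))
      (harmDefect ℚ_[p] n) := by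
  have hpc : (p : ℚ_[p]) = 4 * n + 3 := by exact_mod_cast congrArg (Nat.cast (R := ℚ_[p])) hp
  have hp2 : p ≠ 2 := by omega
  have hf (k : ℕ) : (k.factorial : ℚ_[p]) ≠ 0 := by exact_mod_cast Nat.factorial_ne_zero _
  have hn1 : (n : ℚ_[p]) + 1 ≠ 0 := by exact_mod_cast n.succ_ne_zero
  have hoddinv {j : ℕ} (hj : j ≤ n) : (2 * (j : ℚ_[p]) + 1)⁻¹ ∈ PadicInt.subring p :=
    inv_mem_of_eq_natCast (a := 2 * j + 1) (by push_cast; ring) (by omega) (by omega)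
  have hodd : (2 * (n : ℚ_[p]) + 1) ∈ PadicInt.subring p := by
    exact_mod_cast natCast_mem (PadicInt.subring p) (2 * n + 1)
  have hmf := inv_factorial_mem (p := p) (show 2 * n + 1 < p by omega)
  set Z := ∑ s ∈ Finset.range (n + 1), halfBinom ℚ_[p] (n - s) / (2 * s + 1) ^ 2 with hZ
  have hZmem : Z ∈ PadicInt.subring p := sum_mem fun s hs => by
    rw [div_eq_mul_inv, ← inv_pow]
    exact mul_mem (halfBinom_mem hp2 _) (pow_mem (hoddinv (by simp at hs; omega)) _)
  have hζ := sum_halfBinom_convolution_sq (K := ℚ_[p]) n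
  rw [← hZ] at hζ
  -- the alternating binomial sum reduces to `Z`
  have s1 : PadicCongr p 1 (∑ s ∈ Finset.range (n + 1),
      (-1) ^ s * ((2 * n + 1).choose (n - s) : ℚ_[p]) / (2 * s + 1) ^ 2) ((-1) ^ n * Z) := by
    rw [hZ, Finset.mul_sum]
    refine PadicCongr.sum _ fun s hs => ?_
    have hs' : s ≤ n := by simp at hs; omega
    have h := (halfBinom_congr_choose hp (show n - s ≤ 2 * n + 1 by omega)).symm.mul_left
      (mul_mem (pow_mem (neg_mem (one_mem _)) n) (pow_mem (hoddinv hs') 2))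
    refine (PadicCongr.of_eq ?_).trans (h.trans (PadicCongr.of_eq ?_))
    · rw [show (-1 : ℚ_[p]) ^ s = (-1) ^ n * (-1) ^ (n - s) by
        rw [← pow_add, show n + (n - s) = 2 * (n - s) + s by omega, pow_add, pow_mul]; norm_num]
      rw [inv_pow]
      ring
    · rw [inv_pow]
      ring
  have exact1 : ∑ k ∈ Finset.range (n + 1), halfBinom ℚ_[p] k ^ 2 / (2 * k + 1)
      = (2 * n + 1) ^ 2 * halfBinom ℚ_[p] n ^ 2 * (n.factorial : ℚ_[p]) ^ 2 *
        ((2 * n + 1).factorial : ℚ_[p])⁻¹ * ∑ s ∈ Finset.range (n + 1),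
          (-1) ^ s * ((2 * n + 1).choose (n - s) : ℚ_[p]) / (2 * s + 1) ^ 2 := by
    rw [sum_halfBinom_sq_div_odd, mul_assoc _ (((2 * n + 1).factorial : ℚ_[p])⁻¹)]
    congr 1
    rw [Finset.mul_sum]
    refine Finset.sum_congr rfl fun s hs => ?_
    have hs' : s ≤ n := by simp at hs; omega
    rw [Nat.cast_choose ℚ_[p] (by omega), show 2 * n + 1 - (n - s) = n + 1 + s by omega]
    have := hf (2 * n + 1)
    field_simp
  have s2 := s1.mul_left (mul_mem (mul_mem (mul_mem (pow_mem hodd 2)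
    (pow_mem (halfBinom_mem hp2 n) 2)) (pow_mem (natCast_mem _ n.factorial) 2)) hmf)
  rw [← exact1] at s2
  -- replace one factor `halfBinom n` by a binomial coefficient
  have hnf1 := inv_mem_of_eq_natCast (p := p) (x := (n : ℚ_[p]) + 1) (a := n + 1)
    (by push_cast; ring) (by omega) (by omega)
  have s3 := (halfBinom_congr_choose hp (show n ≤ 2 * n + 1 by omega)).mul_left
    (mul_mem (mul_mem (mul_mem (mul_mem (mul_mem (pow_mem hodd 2) (halfBinom_mem hp2 n))
      (pow_mem (natCast_mem _ n.factorial) 2)) hmf) (pow_mem (neg_mem (one_mem _)) n)) hZmem)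
  have s4 : PadicCongr p 1 (∑ k ∈ Finset.range (n + 1), halfBinom ℚ_[p] k ^ 2 / (2 * k + 1))
      ((2 * n + 1) * ((n : ℚ_[p]) + 1)⁻¹ * ((2 * n + 1) * halfBinom ℚ_[p] n * Z)) := by
    refine s2.trans ((PadicCongr.of_eq ?_).trans (s3.trans (PadicCongr.of_eq ?_)))
    · ring
    · rw [Nat.cast_choose ℚ_[p] (by omega), show 2 * n + 1 - n = n + 1 by omega,
        Nat.factorial_succ n]
      have := hf (2 * n + 1)
      have := hf n
      have hs : ((-1 : ℚ_[p]) ^ n) ^ 2 = 1 := by rw [← pow_mul, mul_comm, pow_mul]; norm_num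
      push_cast
      field_simp
      rw [hs]
      ring
  have hζmem : (2 * n + 1) * halfBinom ℚ_[p] n * Z ∈ PadicInt.subring p :=
    mul_mem (mul_mem hodd (halfBinom_mem hp2 n)) hZmem
  -- Here (2n+1)/(n+1) ≡ -2, because 2n+1 + 2(n+1) = p.
  have s5 : PadicCongr p 1 ((2 * n + 1) * ((n : ℚ_[p]) + 1)⁻¹ *
      ((2 * n + 1) * halfBinom ℚ_[p] n * Z)) (-2 * ((2 * n + 1) * halfBinom ℚ_[p] n * Z)) := by
    refine padicCongr_of_eq (mul_mem hnf1 hζmem) ?_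
    rw [hpc]
    field_simp
    ring
  refine s4.trans (s5.trans ?_)
  rw [hζ, harmDefect, Finset.mul_sum]
  refine PadicCongr.sum _ fun k hk => ?_
  have hk' : k ≤ n := by simp at hk; omega
  have s6 : PadicCongr p 1 (∑ j ∈ Finset.Ico k (n + 1), 1 / (2 * (j : ℚ_[p]) + 1))
      (-(1 / 2) * (harm ℚ_[p] (2 * n + 1 - k) - harm ℚ_[p] n)) := by
    refine (PadicCongr.sum _ fun j hj =>
      one_div_odd_congr hp (show j ≤ n by simp at hj; omega)).trans (PadicCongr.of_eq ?_)
    rw [← Finset.mul_sum, Finset.sum_Ico_eq_sub _ (show k ≤ n + 1 by omega),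
      harm_sub_harm (show n + 1 ≤ 2 * n + 1 by omega), harm_sub_harm (show k ≤ 2 * n + 1 by omega),
      show 2 * n + 1 - (n + 1) = n by omega]
    ring
  have h2mem : (-2 : ℚ_[p]) ∈ PadicInt.subring p := by
    exact_mod_cast intCast_mem (PadicInt.subring p) (-2)
  have s7 := (s6.sub (PadicCongr.refl ((harm ℚ_[p] n - harm ℚ_[p] k) / 2))).mul_left
    (mul_mem h2mem (pow_mem (halfBinom_mem hp2 k) 2))
  refine (PadicCongr.of_eq ?_).trans (s7.trans (PadicCongr.of_eq ?_)) <;> ring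

end Middle

/-! ### The cube sum modulo p^4 in terms of A. -/

section Middle

variable {p n : ℕ} [Fact p.Prime]

theorem halfBinom_sq_reflect_congr (hp : p = 4 * n + 3) {k : ℕ} (hk : k ≤ 2 * n + 1) :
    PadicCongr p 1 (halfBinom ℚ_[p] (2 * n + 1 - k) ^ 2) (halfBinom ℚ_[p] k ^ 2) := by
  have h := halfBinom_sq_congr_choose hp (show 2 * n + 1 - k ≤ 2 * n + 1 by omega)
  rw [Nat.choose_symm hk] at h
  exact h.trans (halfBinom_sq_congr_choose hp hk).symm

/-- The term `k = 0` of the left-hand side vanishes. -/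
theorem sum_halfBinom_sq_div_congr (hp : p = 4 * n + 3) :
    PadicCongr p 1 (∑ k ∈ Finset.range (n + 1), halfBinom ℚ_[p] k ^ 2 / (k : ℚ_[p]))
      (2 * harmDefect ℚ_[p] n - 2 * harm ℚ_[p] (2 * n + 1)) := by
  -- The sum over the full range is -2H_m by the Legendre evaluation. Its reflected upper half is
  -- -2A, since 1/(m-k) ≡ -2/(2k+1).
  have h1 : PadicCongr p 1
      (∑ k ∈ Finset.range (2 * n + 2), halfBinom ℚ_[p] k ^ 2 / (k : ℚ_[p]))
      (-2 * harm ℚ_[p] (2 * n + 1)) := by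
    rw [Finset.sum_range_succ', ← sum_legendreCoeff_div]
    simp only [Nat.cast_zero, div_zero, add_zero]
    refine PadicCongr.sum _ fun k hk => ?_
    have hk' : k + 1 ≤ 2 * n + 1 := by simp at hk; omega
    have h := ((halfBinom_sq_congr_legendreCoeff hp hk').mono one_le_two).mul_left
      (inv_natCast_mem_of_lt (p := p) (Nat.succ_pos k) (by omega))
    refine (PadicCongr.of_eq ?_).trans (h.trans (PadicCongr.of_eq ?_))
    · rw [div_eq_mul_inv, mul_comm]
    · rw [div_eq_mul_inv, mul_comm]
      push_cast
      ring
  rw [sum_range_reflect_halves] at h1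
  have h2 : PadicCongr p 1 (∑ k ∈ Finset.range (n + 1),
      halfBinom ℚ_[p] (2 * n + 1 - k) ^ 2 / ((2 * n + 1 - k : ℕ) : ℚ_[p]))
      (-2 * harmDefect ℚ_[p] n) := by
    have h2mem : (-2 : ℚ_[p]) ∈ PadicInt.subring p := by
      exact_mod_cast intCast_mem (PadicInt.subring p) (-2)
    refine PadicCongr.trans ?_ ((sum_halfBinom_sq_div_odd_congr hp).mul_left h2mem)
    rw [Finset.mul_sum]
    refine PadicCongr.sum _ fun k hk => ?_
    have hk' : k ≤ n := by simp at hk; omega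
    have e1 := (halfBinom_sq_reflect_congr hp (show k ≤ 2 * n + 1 by omega)).mul_left
      (inv_natCast_mem_of_lt (p := p) (show 0 < 2 * n + 1 - k by omega) (by omega))
    have e2 := (one_div_odd_congr hp hk').symm.mul_left
      (mul_mem h2mem (pow_mem (halfBinom_mem (p := p) (by omega) k) 2))
    refine (PadicCongr.of_eq ?_).trans (e1.trans ((PadicCongr.of_eq ?_).trans
      (e2.trans (PadicCongr.of_eq ?_)))) <;> ring
  refine (PadicCongr.of_eq ?_).trans ((h1.sub h2).trans (PadicCongr.of_eq ?_)) <;> ring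

/-- Only k = 0 has p in a denominator, giving the -1. For k > 0 one has -1/(p-2k) ≡ 1/(2k), so the
rest is p times the two sums already known modulo p. In the intermediate sum the default 1/0 = 0
suppresses the k = 0 term of h_k^2/k. -/
theorem sum_choose_sq_congr (hp : p = 4 * n + 3) :
    PadicCongr p 2 ((4 * n + 3) * ∑ k ∈ Finset.range (n + 1), ((2 * n + 1).choose k : ℚ_[p]) ^ 2 *
          (1 / (2 * k + 1) - 1 / (4 * n + 3 - 2 * k)))
      (-1 + p * (2 * harmDefect ℚ_[p] n - harm ℚ_[p] (2 * n + 1))) := by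
  have hpc : (p : ℚ_[p]) = 4 * n + 3 := by exact_mod_cast congrArg (Nat.cast (R := ℚ_[p])) hp
  have hp0 : (p : ℚ_[p]) ≠ 0 := by exact_mod_cast (by omega : p ≠ 0)
  have hi := inv_two_mem (p := p) (by omega)
  have h1 : PadicCongr p 2
      ((4 * n + 3) * ∑ k ∈ Finset.range (n + 1), ((2 * n + 1).choose k : ℚ_[p]) ^ 2 *
          (1 / (2 * k + 1) - 1 / (4 * n + 3 - 2 * k)))
      (∑ k ∈ Finset.range (n + 1), (p * (halfBinom ℚ_[p] k ^ 2 / (2 * k + 1)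
        + 2⁻¹ * (halfBinom ℚ_[p] k ^ 2 / (k : ℚ_[p]))) + if k = 0 then -1 else 0)) := by
    rw [Finset.mul_sum, ← hpc]
    refine PadicCongr.sum _ fun k hk => ?_
    have hk' : k ≤ n := by simp at hk; omega
    rcases Nat.eq_zero_or_pos k with rfl | hk0
    · refine PadicCongr.of_eq ?_
      simp [halfBinom_zero]
      field_simp
      ring
    · have hkc : (k : ℚ_[p]) ≠ 0 := by exact_mod_cast hk0.ne'
      have e0 := (halfBinom_sq_congr_choose hp (show k ≤ 2 * n + 1 by omega)).symm
      have m1 : (2 * (k : ℚ_[p]) + 1)⁻¹ ∈ PadicInt.subring p :=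
        inv_mem_of_eq_natCast (a := 2 * k + 1) (by push_cast; ring) (by omega) (by omega)
      have m2 : (k : ℚ_[p])⁻¹ ∈ PadicInt.subring p := inv_natCast_mem_of_lt hk0 (by omega)
      have m3 : ((p : ℚ_[p]) - 2 * k)⁻¹ ∈ PadicInt.subring p :=
        inv_mem_of_eq_natCast (a := p - 2 * k) (by rw [Nat.cast_sub (by omega)]; push_cast; ring)
          (by omega) (by omega)
      have n3 : (p : ℚ_[p]) - 2 * k ≠ 0 := by
        have : ((p - 2 * k : ℕ) : ℚ_[p]) ≠ 0 := by exact_mod_cast (by omega : p - 2 * k ≠ 0)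
        rw [Nat.cast_sub (by omega)] at this
        push_cast at this
        exact this
      have e1 : PadicCongr p 1 (-((p : ℚ_[p]) - 2 * k)⁻¹) (2⁻¹ * (k : ℚ_[p])⁻¹) := by
        refine padicCongr_of_eq (z := -(2⁻¹ * (k : ℚ_[p])⁻¹ * ((p : ℚ_[p]) - 2 * k)⁻¹))
          (neg_mem (mul_mem (mul_mem hi m2) m3)) ?_
        field_simp
        ring
      have e2 := (e0.mul (pow_mem (natCast_mem _ _) 2)
        (add_mem m1 (neg_mem m3)) ((PadicCongr.refl ((2 * (k : ℚ_[p]) + 1)⁻¹)).add e1))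
      refine (PadicCongr.of_eq ?_).trans (e2.p_mul.trans (PadicCongr.of_eq ?_))
      · ring
      · rw [if_neg hk0.ne']
        ring
  refine h1.trans ?_
  rw [Finset.sum_add_distrib, ← Finset.mul_sum, Finset.sum_add_distrib, ← Finset.mul_sum,
    Finset.sum_ite_eq' (Finset.range (n + 1)) 0 (fun _ => (-1 : ℚ_[p])), if_pos (by simp)]
  have h3 := ((sum_halfBinom_sq_div_odd_congr hp).add
    ((sum_halfBinom_sq_div_congr hp).mul_left hi)).p_mul.add (PadicCongr.refl (-1))
  refine h3.trans (PadicCongr.of_eq ?_)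
  ring

/-- As n+3/4 = p/4, the product (j-n-1/2)(j+n+1) equals (j+1/4)^2 - p^2/16. The factor n+1+j comes
from the ratio of consecutive 1/(n+1+k). -/
theorem sum_quarter_congr (hp : p = 4 * n + 3) :
    PadicCongr p 2
      (∑ k ∈ Finset.range (n + 1), ∏ j ∈ Finset.range k,
        (((n : ℚ_[p]) + 3 / 2 + j) * ((j : ℚ_[p]) + 1 / 4) ^ 2 /
          (((j : ℚ_[p]) + 1) ^ 2 * (n + 2 + j))))
      ((n + 1) * ∑ k ∈ Finset.range (n + 1),
        legendreCoeff ((n : ℚ_[p]) + 1 / 2) k / (n + 1 + k)) := by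
  have hpc : (p : ℚ_[p]) = 4 * n + 3 := by exact_mod_cast congrArg (Nat.cast (R := ℚ_[p])) hp
  have hi := inv_two_mem (p := p) (by omega)
  -- Used with b = 6 for n+j+3/2 and with b = 1 for j+1/4.
  have hc (a b : ℕ) : (a : ℚ_[p]) + b * 2⁻¹ ^ 2 ∈ PadicInt.subring p :=
    add_mem (natCast_mem _ a) (mul_mem (natCast_mem _ b) (pow_mem hi 2))
  have h1 (k : ℕ) : (n + 1) * (legendreCoeff ((n : ℚ_[p]) + 1 / 2) k / (n + 1 + k))
      = ∏ j ∈ Finset.range k, (((n : ℚ_[p]) + 3 / 2 + j) *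
        (((j : ℚ_[p]) - n - 1 / 2) * (n + 1 + j)) / (((j : ℚ_[p]) + 1) ^ 2 * (n + 2 + j))) := by
    have hn (i : ℕ) : (n : ℚ_[p]) + 1 + i ≠ 0 := by exact_mod_cast (by omega : n + 1 + i ≠ 0)
    induction k with
    | zero =>
      have := hn 0
      simp [legendreCoeff_zero] at this ⊢
      field_simp
    | succ k ih =>
      rw [Finset.prod_range_succ, ← ih, legendreCoeff_succ]
      have a1 := hn k
      have a2 : (n : ℚ_[p]) + 2 + k ≠ 0 := by exact_mod_cast (by omega : n + 2 + k ≠ 0)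
      have a3 : (k : ℚ_[p]) + 1 ≠ 0 := by exact_mod_cast k.succ_ne_zero
      push_cast
      rw [show (n : ℚ_[p]) + 1 + (k + 1) = n + 2 + k by ring]
      field_simp
      ring
  rw [Finset.mul_sum]
  refine PadicCongr.sum _ fun k hk => ?_
  have hk' : k ≤ n := by simp at hk; omega
  rw [h1]
  refine PadicCongr.prod _ (fun j hj => ?_) fun j hj => ?_
  all_goals
    have hj' : j < k := by simpa using hj
    have m1 : ((j : ℚ_[p]) + 1)⁻¹ ∈ PadicInt.subring p :=
      inv_mem_of_eq_natCast (a := j + 1) (by push_cast; ring) (by omega) (by omega)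
    have m2 : ((n : ℚ_[p]) + 2 + j)⁻¹ ∈ PadicInt.subring p :=
      inv_mem_of_eq_natCast (a := n + 2 + j) (by push_cast; ring) (by omega) (by omega)
    have m3 := mul_mem (mul_mem (hc (n + j) 6) (pow_mem m1 2)) m2
  · convert mul_mem m3 (pow_mem (hc j 1) 2) using 1
    push_cast
    field_simp
    ring
  · refine padicCongr_of_eq (mul_mem m3 (pow_mem (pow_mem hi 2) 2)) ?_
    have a2 : (n : ℚ_[p]) + 2 + j ≠ 0 := by exact_mod_cast (by omega : n + 2 + j ≠ 0)
    have a3 : (j : ℚ_[p]) + 1 ≠ 0 := by exact_mod_cast j.succ_ne_zero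
    rw [hpc]
    push_cast
    field_simp
    ring

/-- The unit factor of the cube sum. -/
def cubeUnit (K : Type*) [Field K] (n : ℕ) : K :=
  (∏ j ∈ Finset.range n, (2 * (j : K) + 3 / 2)) ^ 2 / ((2 * n + 2).factorial : K) * (n + 1) *
    ((-1) ^ n * halfBinom K (2 * n + 1) * (n.factorial : K) ^ 2 / (2 * n + 1).factorial)

theorem prod_three_halves_mem (hp2 : p ≠ 2) (n : ℕ) :
    ∏ j ∈ Finset.range n, (2 * (j : ℚ_[p]) + 3 / 2) ∈ PadicInt.subring p := by
  refine prod_mem fun j _ => ?_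
  convert mul_mem (inv_two_mem (p := p) hp2) (natCast_mem (PadicInt.subring p) (4 * j + 3)) using 1
  push_cast
  ring

theorem cubeUnit_mem (hp : p = 4 * n + 3) : cubeUnit ℚ_[p] n ∈ PadicInt.subring p := by
  rw [cubeUnit, div_eq_mul_inv, div_eq_mul_inv]
  exact mul_mem (mul_mem (mul_mem (pow_mem (prod_three_halves_mem (by omega) n) 2)
    (inv_factorial_mem (by omega))) (add_mem (natCast_mem _ n) (one_mem _)))
    (mul_mem (mul_mem (mul_mem (pow_mem (neg_mem (one_mem _)) n) (halfBinom_mem (by omega) _))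
      (pow_mem (natCast_mem _ _) 2)) (inv_factorial_mem (by omega)))

/-- The factor j = n of the prefactor is (2n+3/2)^2 = p^2/4; it promotes congruences modulo p^2 to
modulo p^4. -/
theorem sum_halfBinom_cube_congr (hp : p = 4 * n + 3) :
    PadicCongr p 4 (∑ k ∈ Finset.range (2 * n + 2), halfBinom ℚ_[p] k ^ 3)
      (p ^ 2 * (4⁻¹ * (cubeUnit ℚ_[p] n *
        (-1 + p * (2 * harmDefect ℚ_[p] n - harm ℚ_[p] (2 * n + 1)))))) := by
  have hpc : (p : ℚ_[p]) = 4 * n + 3 := by exact_mod_cast congrArg (Nat.cast (R := ℚ_[p])) hp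
  have hi4 := inv_four_mem (p := p) (by omega)
  have m1 := mul_mem (pow_mem (prod_three_halves_mem (p := p) (by omega) n) 2)
    (inv_factorial_mem (p := p) (show 2 * n + 2 < p by omega))
  have m2 : (n : ℚ_[p]) + 1 ∈ PadicInt.subring p := add_mem (natCast_mem _ n) (one_mem _)
  have m3 : (-1) ^ n * halfBinom ℚ_[p] (2 * n + 1) * (n.factorial : ℚ_[p]) ^ 2 *
      ((2 * n + 1).factorial : ℚ_[p])⁻¹ ∈ PadicInt.subring p :=
    mul_mem (mul_mem (mul_mem (pow_mem (neg_mem (one_mem _)) n) (halfBinom_mem (by omega) _))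
      (pow_mem (natCast_mem _ _) 2)) (inv_factorial_mem (by omega))
  have h1 := (sum_quarter_congr hp).mul_left (mul_mem hi4 m1)
  rw [sum_legendreCoeff_quarter] at h1
  have h2 := (sum_choose_sq_congr hp).mul_left (mul_mem (mul_mem (mul_mem hi4 m1) m2) m3)
  have h3 := (h1.trans ((PadicCongr.of_eq (by ring)).trans h2)).pow_mul 2
  rw [sum_halfBinom_cube]
  refine (PadicCongr.of_eq ?_).trans (h3.trans (PadicCongr.of_eq ?_))
  · simp only [cubeTerm]
    rw [← Finset.mul_sum, Finset.prod_range_succ, Finset.prod_pow, hpc]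
    ring
  · rw [cubeUnit]
    ring

end Middle

/-! ### Exact factorial and harmonic identities for the unit factor. -/

section Exact

variable {K : Type*} [Field K] [CharZero K]

/-- Splits ∏ (l+1/2) over l < 2n+1 by the parity of l. -/
theorem factorial_mul_halfBinom_odd (n : ℕ) :
    ((2 * n + 1).factorial : K) * halfBinom K (2 * n + 1)
      = 2 ^ (n + 1) * (∏ j ∈ Finset.range (n + 1), ((j : K) + 1 / 4)) *
        ∏ j ∈ Finset.range n, (2 * (j : K) + 3 / 2) := by
  rw [← prod_add_half]
  induction n with
  | zero => norm_num
  | succ n ih =>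
    rw [show 2 * (n + 1) + 1 = 2 * n + 1 + 1 + 1 by ring, Finset.prod_range_succ,
      Finset.prod_range_succ, ih, Finset.prod_range_succ _ (n + 1),
      Finset.prod_range_succ (fun j : ℕ => 2 * (j : K) + 3 / 2) n]
    push_cast
    ring

theorem factorial_mul_prod_odd (n : ℕ) :
    (2 : K) ^ n * n.factorial * ∏ j ∈ Finset.range (n + 1), (2 * (j : K) + 1)
      = (2 * n + 1).factorial := by
  induction n with
  | zero => simp
  | succ n ih =>
    rw [show 2 * (n + 1) + 1 = 2 * n + 1 + 1 + 1 by ring, Finset.prod_range_succ,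
      Nat.factorial_succ, Nat.factorial_succ, Nat.factorial_succ]
    push_cast
    rw [← ih]
    ring

theorem sum_one_div_odd (n : ℕ) :
    ∑ j ∈ Finset.range (n + 1), 1 / (2 * (j : K) + 1)
      = harm K (2 * n + 1) - harm K n / 2 := by
  induction n with
  | zero => simp [harm]
  | succ n ih =>
    rw [Finset.sum_range_succ, ih, show 2 * (n + 1) + 1 = 2 * n + 1 + 1 + 1 by ring, harm_succ n,
      harm_succ (2 * n + 1 + 1), harm_succ (2 * n + 1)]
    have h1 : (n : K) + 1 ≠ 0 := by exact_mod_cast n.succ_ne_zero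
    have h2 : 2 * (n : K) + 3 ≠ 0 := by exact_mod_cast (by omega : 2 * n + 3 ≠ 0)
    push_cast
    rw [show 2 * (n : K) + 1 + 1 = 2 * (n + 1) by ring,
      show 2 * ((n : K) + 1) + 1 = 2 * n + 3 by ring]
    field_simp
    ring

end Exact

/-! ### First-order expansions of products, of 2^m and of the unit factor. -/

section Middle

variable {p n : ℕ} [Fact p.Prime]

theorem prod_mul_one_add_p_mul {ι : Type*} (s : Finset ι) {a c f : ι → ℚ_[p]}
    (ha : ∀ i ∈ s, a i ∈ PadicInt.subring p) (hc : ∀ i ∈ s, c i ∈ PadicInt.subring p)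
    (hf : ∀ i ∈ s, f i = c i * (1 + p * a i)) :
    PadicCongr p 2 (∏ i ∈ s, f i) ((∏ i ∈ s, c i) * (1 + p * ∑ i ∈ s, a i)) := by
  rw [Finset.prod_congr rfl hf, Finset.prod_mul_distrib]
  exact (prod_one_add_p_mul s ha).mul_left (prod_mem hc)

/-- Expand 2j+3/2 = -2(n-j) + p/2. -/
theorem prod_three_halves_congr (hp : p = 4 * n + 3) :
    PadicCongr p 2 (∏ j ∈ Finset.range n, (2 * (j : ℚ_[p]) + 3 / 2))
      ((-2) ^ n * n.factorial * (1 - p * (4⁻¹ * harm ℚ_[p] n))) := by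
  have hpc : (p : ℚ_[p]) = 4 * n + 3 := by exact_mod_cast congrArg (Nat.cast (R := ℚ_[p])) hp
  have h2mem : (-2 : ℚ_[p]) ∈ PadicInt.subring p := by
    exact_mod_cast intCast_mem (PadicInt.subring p) (-2)
  refine (prod_mul_one_add_p_mul (Finset.range n) (c := fun j => -2 * ((n - j : ℕ) : ℚ_[p]))
    (a := fun j => -4⁻¹ * (1 / ((n - j : ℕ) : ℚ_[p]))) (fun j hj => ?_)
    (fun j _ => mul_mem h2mem (natCast_mem _ _)) fun j hj => ?_).trans (PadicCongr.of_eq ?_)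
  · rw [one_div]
    exact mul_mem (neg_mem (inv_four_mem (by omega)))
      (inv_natCast_mem_of_lt (by simp at hj; omega) (by omega))
  · have hj' : j < n := by simpa using hj
    have h0 : ((n - j : ℕ) : ℚ_[p]) ≠ 0 := by exact_mod_cast (by omega : n - j ≠ 0)
    rw [Nat.cast_sub hj'.le] at h0 ⊢
    rw [hpc]
    field_simp
    ring
  · rw [← Finset.mul_sum, harm_sub_harm le_rfl, Finset.prod_mul_distrib, ← Nat.cast_prod,
      ← Nat.descFactorial_eq_prod_range, Nat.descFactorial_self]
    simp [harm, sub_eq_add_neg]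

/-- After reversing the product, n-j+1/4 = (2n+1-j) - p/4. -/
theorem prod_quarter_congr (hp : p = 4 * n + 3) :
    PadicCongr p 2 (∏ j ∈ Finset.range (n + 1), ((j : ℚ_[p]) + 1 / 4))
      ((2 * n + 1).descFactorial (n + 1) *
        (1 - p * (4⁻¹ * (harm ℚ_[p] (2 * n + 1) - harm ℚ_[p] n)))) := by
  have hpc : (p : ℚ_[p]) = 4 * n + 3 := by exact_mod_cast congrArg (Nat.cast (R := ℚ_[p])) hp
  rw [← Finset.prod_range_reflect]
  refine (prod_mul_one_add_p_mul _ (c := fun j => ((2 * n + 1 - j : ℕ) : ℚ_[p]))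
    (a := fun j => -4⁻¹ * (1 / ((2 * n + 1 - j : ℕ) : ℚ_[p]))) (fun j hj => ?_)
    (fun j _ => natCast_mem _ _) fun j hj => ?_).trans (PadicCongr.of_eq ?_)
  · rw [one_div]
    exact mul_mem (neg_mem (inv_four_mem (by omega)))
      (inv_natCast_mem_of_lt (by simp at hj; omega) (by omega))
  · have hj' : j ≤ n := by simp at hj; omega
    have h0 : ((2 * n + 1 - j : ℕ) : ℚ_[p]) ≠ 0 := by exact_mod_cast (by omega : 2 * n + 1 - j ≠ 0)
    rw [Nat.cast_sub (by omega)] at h0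
    rw [show n + 1 - 1 - j = n - j by omega, Nat.cast_sub hj',
      Nat.cast_sub (show j ≤ 2 * n + 1 by omega), hpc]
    field_simp
    push_cast
    ring
  · rw [← Finset.mul_sum, harm_sub_harm (by omega), ← Nat.cast_prod,
      ← Nat.descFactorial_eq_prod_range, show 2 * n + 1 - (n + 1) = n by omega]
    ring

theorem factorial_pred_congr (hp : p = 4 * n + 3) :
    PadicCongr p 2 ((p - 1).factorial : ℚ_[p])
      (-((2 * n + 1).factorial : ℚ_[p]) ^ 2 * (1 - p * harm ℚ_[p] (2 * n + 1))) := by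
  have hpc : (p : ℚ_[p]) = 4 * n + 3 := by exact_mod_cast congrArg (Nat.cast (R := ℚ_[p])) hp
  have h1 : ((p - 1).factorial : ℚ_[p]) = (2 * n + 1).factorial *
      ∏ j ∈ Finset.range (2 * n + 1), ((p : ℚ_[p]) - (j + 1)) := by
    rw [← Nat.factorial_mul_descFactorial (show 2 * n + 1 ≤ p - 1 by omega),
      Nat.descFactorial_eq_prod_range, show p - 1 - (2 * n + 1) = 2 * n + 1 by omega]
    push_cast
    congr 1
    refine Finset.prod_congr rfl fun j hj => ?_
    simp at hj
    rw [Nat.cast_sub (by omega), Nat.cast_sub (by omega)]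
    push_cast
    ring
  have h2 := prod_mul_one_add_p_mul (Finset.range (2 * n + 1)) (p := p)
    (c := fun j => -1 * ((j + 1 : ℕ) : ℚ_[p])) (a := fun j => -1 * (1 / ((j : ℚ_[p]) + 1)))
    (f := fun j => (p : ℚ_[p]) - (j + 1)) (fun j hj => ?_)
    (fun j _ => mul_mem (neg_mem (one_mem _)) (natCast_mem _ _)) fun j hj => ?_
  · rw [h1]
    refine (h2.mul_left (natCast_mem _ _)).trans (PadicCongr.of_eq ?_)
    rw [← Finset.mul_sum, Finset.prod_mul_distrib, ← Nat.cast_prod,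
      Finset.prod_range_add_one_eq_factorial, harm, Finset.prod_const, Finset.card_range,
      Odd.neg_one_pow ⟨n, rfl⟩]
    ring
  · rw [one_div]
    exact mul_mem (neg_mem (one_mem _)) (inv_mem_of_eq_natCast (a := j + 1)
      (by push_cast; ring) (by omega) (by simp at hj; omega))
  · have : (j : ℚ_[p]) + 1 ≠ 0 := by exact_mod_cast j.succ_ne_zero
    push_cast
    field_simp
    ring

/-- Expand the even numbers 2(m-j) = p - (2j+1) around the odd ones, then cancel m!. -/
theorem two_pow_congr_of_even_factors (hp : p = 4 * n + 3) :
    PadicCongr p 2 ((-1) ^ (n + 1) * 2 ^ (2 * n + 1))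
      (1 - p * (harm ℚ_[p] (2 * n + 1) - 2⁻¹ * harm ℚ_[p] n)) := by
  have hpc : (p : ℚ_[p]) = 4 * n + 3 := by exact_mod_cast congrArg (Nat.cast (R := ℚ_[p])) hp
  have hf (k : ℕ) : (k.factorial : ℚ_[p]) ≠ 0 := by exact_mod_cast Nat.factorial_ne_zero _
  have h2 := prod_mul_one_add_p_mul (Finset.range (n + 1)) (p := p)
    (c := fun j => -1 * (2 * (j : ℚ_[p]) + 1)) (a := fun j => -1 * (1 / (2 * (j : ℚ_[p]) + 1)))
    (f := fun j => 2 * ((2 * n + 1 - j : ℕ) : ℚ_[p])) (fun j hj => ?_)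
    (fun j _ => mul_mem (neg_mem (one_mem _)) (by
      exact_mod_cast natCast_mem (PadicInt.subring p) (2 * j + 1))) fun j hj => ?_
  · refine PadicCongr.cancel (hf (2 * n + 1)) (inv_factorial_mem (by omega)) ?_
    refine (PadicCongr.of_eq ?_).trans ((h2.mul_left (c := (-1) ^ (n + 1) * (2 ^ n * n.factorial))
      ?_).trans (PadicCongr.of_eq ?_))
    · rw [Finset.prod_mul_distrib, ← Nat.cast_prod, ← Nat.descFactorial_eq_prod_range,
        Finset.prod_const, Finset.card_range,
        ← Nat.factorial_mul_descFactorial (show n + 1 ≤ 2 * n + 1 by omega),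
        show 2 * n + 1 - (n + 1) = n by omega]
      push_cast
      ring
    · exact mul_mem (pow_mem (neg_mem (one_mem _)) _)
        (by exact_mod_cast natCast_mem (PadicInt.subring p) (2 ^ n * n.factorial))
    · rw [← Finset.mul_sum, Finset.prod_mul_distrib, sum_one_div_odd, Finset.prod_const,
        Finset.card_range, ← factorial_mul_prod_odd]
      have hs : ((-1 : ℚ_[p]) ^ (n + 1)) * (-1) ^ (n + 1) = 1 := by rw [← mul_pow]; norm_num
      linear_combination (2 ^ n * (n.factorial : ℚ_[p]) *
        (∏ j ∈ Finset.range (n + 1), (2 * (j : ℚ_[p]) + 1)) *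
        (1 - p * (harm ℚ_[p] (2 * n + 1) - 2⁻¹ * harm ℚ_[p] n))) * hs
  · rw [one_div]
    exact mul_mem (neg_mem (one_mem _)) (inv_mem_of_eq_natCast (a := 2 * j + 1)
      (by push_cast; ring) (by omega) (by simp at hj; omega))
  · have : 2 * (j : ℚ_[p]) + 1 ≠ 0 := by exact_mod_cast (2 * j).succ_ne_zero
    rw [Nat.cast_sub (by simp at hj; omega), hpc]
    push_cast
    field_simp
    ring

theorem halfBinom_middle_congr (hp : p = 4 * n + 3) :
    PadicCongr p 2 (halfBinom ℚ_[p] (2 * n + 1))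
      (-(1 - p * (2⁻¹ * harm ℚ_[p] (2 * n + 1)))) := by
  refine (halfBinom_congr hp le_rfl).trans (PadicCongr.of_eq ?_)
  rw [Nat.choose_self, Odd.neg_one_pow ⟨n, rfl⟩, Nat.sub_self]
  simp [harm]
  ring

/-- Compares two expansions of h_m: the one from the parity splitting, which contains 2^m, and the
one from C(m,m) = 1. -/
theorem two_pow_congr_of_halfBinom (hp : p = 4 * n + 3) :
    PadicCongr p 2 ((-1) ^ (n + 1) * 2 ^ (2 * n + 1))
      (1 - p * (4⁻¹ * harm ℚ_[p] (2 * n + 1))) := by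
  have hf (k : ℕ) : (k.factorial : ℚ_[p]) ≠ 0 := by exact_mod_cast Nat.factorial_ne_zero _
  have hi4 := inv_four_mem (p := p) (by omega)
  have mn := harm_mem (p := p) (show n < p by omega)
  have mm := harm_mem (p := p) (show 2 * n + 1 < p by omega)
  have mP := prod_three_halves_mem (p := p) (by omega) n
  have m2 : (2 : ℚ_[p]) ∈ PadicInt.subring p := natCast_mem _ 2
  have mp : (p : ℚ_[p]) ∈ PadicInt.subring p := natCast_mem _ p
  have ms (k : ℕ) : (-1 : ℚ_[p]) ^ k ∈ PadicInt.subring p := pow_mem (neg_mem (one_mem _)) k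
  have h := (prod_quarter_congr hp).mul_left (mul_mem (pow_mem m2 (n + 1)) mP)
  have h' := (prod_three_halves_congr hp).mul_left (mul_mem (mul_mem (pow_mem m2 (n + 1))
    (natCast_mem _ ((2 * n + 1).descFactorial (n + 1))))
    (sub_mem (one_mem _) (mul_mem mp (mul_mem hi4 (sub_mem mm mn)))))
  have h1 : PadicCongr p 2 (((2 * n + 1).factorial : ℚ_[p]) * halfBinom ℚ_[p] (2 * n + 1))
      ((2 * n + 1).factorial * ((-1) ^ n * 2 ^ (2 * n + 1) *
        ((1 - p * (4⁻¹ * (harm ℚ_[p] (2 * n + 1) - harm ℚ_[p] n))) *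
        (1 - p * (4⁻¹ * harm ℚ_[p] n))))) := by
    rw [factorial_mul_halfBinom_odd]
    refine (PadicCongr.of_eq ?_).trans (h.trans ((PadicCongr.of_eq ?_).trans
      (h'.trans (PadicCongr.of_eq ?_))))
    · ring
    · ring
    · rw [← Nat.factorial_mul_descFactorial (show n + 1 ≤ 2 * n + 1 by omega),
        show 2 * n + 1 - (n + 1) = n by omega, show (-2 : ℚ_[p]) = -1 * 2 by ring, mul_pow]
      push_cast
      ring
  have h2 := (h1.cancel (hf _) (inv_factorial_mem (by omega))).symm.trans
    (halfBinom_middle_congr hp)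
  -- multiply by `-(1 + p H / 4)`
  have h3 := h2.mul_left (neg_mem (add_mem (one_mem _) (mul_mem mp (mul_mem hi4 mm))))
  set a := harm ℚ_[p] (2 * n + 1) with ha
  set b := harm ℚ_[p] n with hb
  refine PadicCongr.trans (padicCongr_of_eq (z := -((-1) ^ (n + 1) * 2 ^ (2 * n + 1) *
    (-(4⁻¹ * a) ^ 2 + (4⁻¹ * (a - b)) * (4⁻¹ * b) * (1 + p * (4⁻¹ * a))))) ?_ ?_)
    (h3.trans (padicCongr_of_eq (z := -2 * (4⁻¹ * a) ^ 2) ?_ ?_))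
  · exact neg_mem (mul_mem (mul_mem (ms _) (pow_mem m2 _)) (add_mem (neg_mem
      (pow_mem (mul_mem hi4 mm) 2)) (mul_mem (mul_mem (mul_mem hi4 (sub_mem mm mn))
        (mul_mem hi4 mn)) (add_mem (one_mem _) (mul_mem mp (mul_mem hi4 mm))))))
  · ring
  · exact mul_mem (neg_mem m2) (pow_mem (mul_mem hi4 mm) 2)
  · ring

/-- Twice the second expansion of 2^m minus the first; this combination is the one that cancels H_m
in the unit factor. -/
theorem two_pow_congr (hp : p = 4 * n + 3) :
    PadicCongr p 2 ((-1) ^ (n + 1) * 2 ^ (2 * n + 1))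
      (1 + p * (2⁻¹ * (harm ℚ_[p] (2 * n + 1) - harm ℚ_[p] n))) := by
  have m2 : (2 : ℚ_[p]) ∈ PadicInt.subring p := natCast_mem _ 2
  refine (PadicCongr.of_eq ?_).trans ((((two_pow_congr_of_halfBinom hp).mul_left m2).sub
    (two_pow_congr_of_even_factors hp)).trans (PadicCongr.of_eq ?_)) <;> ring

/-- The factor 1+pH_m converts 1/m!^2 into -1/(p-1)!. The corrections left, -H_n/2 from the squared
product, -H_m/2 from h_m and (H_m-H_n)/2 from 2^m, add up to -H_n. -/
theorem cubeUnit_congr (hp : p = 4 * n + 3) :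
    PadicCongr p 2 (cubeUnit ℚ_[p] n * (1 + p * harm ℚ_[p] (2 * n + 1)))
      (4⁻¹ * -((n.factorial : ℚ_[p]) ^ 4 * (1 - p * harm ℚ_[p] n) *
        ((p - 1).factorial : ℚ_[p])⁻¹)) := by
  have hf (k : ℕ) : (k.factorial : ℚ_[p]) ≠ 0 := by exact_mod_cast Nat.factorial_ne_zero _
  have hi := inv_two_mem (p := p) (by omega)
  have hi4 := inv_four_mem (p := p) (by omega)
  have mn := harm_mem (p := p) (show n < p by omega)
  have mm := harm_mem (p := p) (show 2 * n + 1 < p by omega)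
  have mP := prod_three_halves_mem (p := p) (by omega) n
  have mp : (p : ℚ_[p]) ∈ PadicInt.subring p := natCast_mem _ p
  have ms (k : ℕ) : (-1 : ℚ_[p]) ^ k ∈ PadicInt.subring p := pow_mem (neg_mem (one_mem _)) k
  have mnf : (n.factorial : ℚ_[p]) ∈ PadicInt.subring p := natCast_mem _ _
  have me := halfBinom_mem (p := p) (by omega) (2 * n + 1)
  have mW := inv_factorial_mem (p := p) (show p - 1 < p by omega)
  have mM := inv_factorial_mem (p := p) (show 2 * n + 1 < p by omega)
  have hK : cubeUnit ℚ_[p] n = (∏ j ∈ Finset.range n, (2 * (j : ℚ_[p]) + 3 / 2)) ^ 2 *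
      ((-1) ^ n * halfBinom ℚ_[p] (2 * n + 1) * (n.factorial : ℚ_[p]) ^ 2 * 2⁻¹) *
      ((2 * n + 1).factorial : ℚ_[p])⁻¹ ^ 2 := by
    have hn1 : (n : ℚ_[p]) + 1 ≠ 0 := by exact_mod_cast n.succ_ne_zero
    have := hf (2 * n + 1)
    rw [cubeUnit, show 2 * n + 2 = 2 * n + 1 + 1 by ring, Nat.factorial_succ]
    push_cast
    rw [show 2 * (n : ℚ_[p]) + 1 + 1 = 2 * (n + 1) by ring]
    field_simp
  -- replace the factorial of `2 n + 1`
  have h1 : PadicCongr p 2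
      (((2 * n + 1).factorial : ℚ_[p])⁻¹ ^ 2 * (1 + p * harm ℚ_[p] (2 * n + 1)))
      (-((p - 1).factorial : ℚ_[p])⁻¹) := by
    have h := (factorial_pred_congr hp).mul_left (mul_mem (mul_mem mW (pow_mem mM 2))
      (add_mem (one_mem _) (mul_mem mp mm)))
    have := hf (2 * n + 1)
    have := hf (p - 1)
    refine (PadicCongr.of_eq ?_).trans (h.trans (padicCongr_of_eq
      (z := ((p - 1).factorial : ℚ_[p])⁻¹ * harm ℚ_[p] (2 * n + 1) ^ 2)
      (mul_mem mW (pow_mem mm 2)) ?_))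
    · field_simp
    · field_simp
      ring
  have h2 := (prod_three_halves_congr hp).pow mP 2
  have h3 := h2.mul (pow_mem mP 2) me (halfBinom_middle_congr hp)
  have h4 := h1.mul_left (mul_mem (pow_mem mP 2)
    (mul_mem (mul_mem (mul_mem (ms n) me) (pow_mem mnf 2)) hi))
  have h5 := h3.mul_left (mul_mem (mul_mem (mul_mem (ms n) (pow_mem mnf 2)) hi) (neg_mem mW))
  have h6 := (two_pow_congr hp).mul_left (mul_mem (neg_mem (mul_mem (mul_mem hi4 (pow_mem mnf 4))
    mW)) (mul_mem (pow_mem (sub_mem (one_mem _) (mul_mem mp (mul_mem hi4 mn))) 2)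
    (sub_mem (one_mem _) (mul_mem mp (mul_mem hi mm)))))
  rw [hK]
  refine (PadicCongr.of_eq (by ring)).trans (h4.trans ((PadicCongr.of_eq (by ring)).trans
    (h5.trans ((PadicCongr.of_eq ?_).trans (h6.trans ?_)))))
  · rw [mul_pow, mul_pow, show ((-2 : ℚ_[p]) ^ n) ^ 2 = 2 ^ (2 * n) by
      rw [← pow_mul, mul_comm, pow_mul, pow_mul]; norm_num]
    ring
  · set a := harm ℚ_[p] (2 * n + 1) with ha
    set b := harm ℚ_[p] n with hb
    have mx := mul_mem hi4 mn
    have my := mul_mem hi mm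
    have m2 : (2 : ℚ_[p]) ∈ PadicInt.subring p := natCast_mem _ 2
    have m5 : (5 : ℚ_[p]) ∈ PadicInt.subring p := natCast_mem _ 5
    -- Substituting b = 4x and a = 2y clears denominators, so that the quotient by p^2 becomes an
    -- explicit integral polynomial in x, y and p.
    obtain ⟨x, hx, hxm⟩ : ∃ x, b = 4 * x ∧ x ∈ PadicInt.subring p :=
      ⟨4⁻¹ * b, by ring, mx⟩
    obtain ⟨y, hy, hym⟩ : ∃ y, a = 2 * y ∧ y ∈ PadicInt.subring p :=
      ⟨2⁻¹ * a, by ring, my⟩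
    have mw := mul_mem hym (sub_mem hym (mul_mem m2 hxm))
    refine padicCongr_of_eq (mul_mem (neg_mem (mul_mem (mul_mem hi4 (pow_mem mnf 4)) mW))
      (sub_mem (add_mem (sub_mem (mul_mem m5 (pow_mem hxm 2)) mw)
        (mul_mem mp (sub_mem (mul_mem (mul_mem m2 hxm) mw) (mul_mem m2 (pow_mem hxm 3)))))
        (mul_mem (pow_mem mp 2) (mul_mem (pow_mem hxm 2) mw)))) ?_
    rw [hx, hy]
    ring

end Middle

/-! ### Wilson's theorem modulo p^k and continuity of the p-adic Gamma function. -/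

section Wilson

variable {p : ℕ} [Fact p.Prime]

/-- An odd p cannot divide both a-1 and a+1, so p^k divides one of them. -/
theorem sq_eq_one_iff_of_prime_pow (hp2 : p ≠ 2) {k : ℕ} {x : ZMod (p ^ k)} (h : x * x = 1) :
    x = 1 ∨ x = -1 := by
  have hp := (Fact.out : p.Prime)
  obtain ⟨a, rfl⟩ := ZMod.intCast_surjective x
  have hd : ((p ^ k : ℕ) : ℤ) ∣ (a - 1) * (a + 1) := by
    rw [← ZMod.intCast_zmod_eq_zero_iff_dvd]
    push_cast
    linear_combination h
  push_cast at hd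
  have hpi := Nat.prime_iff_prime_int.1 hp
  by_cases h1 : (p : ℤ) ∣ a - 1
  · have h2 : ¬ (p : ℤ) ∣ a + 1 := fun h2 => by
      have h3 : (p : ℤ) ∣ 2 := by
        have := dvd_sub h2 h1
        ring_nf at this
        exact this
      have h4 : p ∣ 2 := by exact_mod_cast h3
      exact hp2 ((Nat.prime_dvd_prime_iff_eq hp Nat.prime_two).1 h4)
    have h3 := (((Prime.coprime_iff_not_dvd hpi).2 h2).pow_left (m := k)).dvd_of_dvd_mul_right hd
    left
    rw [← sub_eq_zero]
    have := (ZMod.intCast_zmod_eq_zero_iff_dvd (a - 1) (p ^ k)).2 (by exact_mod_cast h3)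
    push_cast at this
    exact this
  · have h3 := (((Prime.coprime_iff_not_dvd hpi).2 h1).pow_left (m := k)).dvd_of_dvd_mul_left hd
    right
    rw [← add_eq_zero_iff_eq_neg]
    have := (ZMod.intCast_zmod_eq_zero_iff_dvd (a + 1) (p ^ k)).2 (by exact_mod_cast h3)
    push_cast at this
    exact this

/-- Pairing units with their inverses leaves only 1 and -1. -/
theorem prod_units_zmod_prime_pow (hp2 : p ≠ 2) (k : ℕ) :
    ∏ x : (ZMod (p ^ k))ˣ, x = -1 := by
  have : (∏ x ∈ (Finset.univ : Finset (ZMod (p ^ k))ˣ).erase (-1), x) = 1 := by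
    refine Finset.prod_involution (fun x _ => x⁻¹) (by simp) (fun a ha h1 h2 => ?_)
      (fun a => by simp [@inv_eq_iff_eq_inv _ _ a]) (by simp)
    have h3 : (a : ZMod (p ^ k)) * a = 1 := by
      have : a * a = 1 := by
        nth_rewrite 1 [← h2]
        simp
      rw [← Units.val_mul, this, Units.val_one]
    rcases sq_eq_one_iff_of_prime_pow hp2 h3 with h | h
    · exact h1 (Units.ext h)
    · simp only [Finset.mem_erase] at ha
      exact ha.1 (Units.ext (by simpa using h))
  rw [← Finset.insert_erase (Finset.mem_univ (-1 : (ZMod (p ^ k))ˣ)),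
    Finset.prod_insert (Finset.notMem_erase _ _), this, mul_one]

open Classical in
/-- The factors of the `p`-adic Gamma function, on residues modulo `N`. -/
noncomputable def gammaFactor (N : ℕ) (x : ZMod N) : ZMod N := -(if IsUnit x then x else 1)

theorem padicGammaNat_eq_prod (m : ℕ) :
    padicGammaNat p m
      = ∏ i ∈ Finset.range m, -(if Nat.Coprime i p then (i : ℤ) else 1) := by
  have h : (Finset.Ioo 0 m).filter (fun k => Nat.Coprime k p)
      = (Finset.range m).filter (fun k => Nat.Coprime k p) := by
    ext k
    simp only [Finset.mem_filter, Finset.mem_Ioo, Finset.mem_range, and_congr_left_iff,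
      and_iff_right_iff_imp]
    intro hk _
    refine Nat.pos_of_ne_zero fun h0 => ?_
    rw [h0, Nat.coprime_zero_left] at hk
    exact (Fact.out : p.Prime).one_lt.ne' hk
  rw [padicGammaNat, h, Finset.prod_filter, Finset.prod_neg, Finset.card_range]

theorem padicGammaNat_cast {k : ℕ} (hk : k ≠ 0) (m : ℕ) :
    ((padicGammaNat p m : ℤ) : ZMod (p ^ k))
      = ∏ i ∈ Finset.range m, gammaFactor (p ^ k) (i : ZMod (p ^ k)) := by
  rw [padicGammaNat_eq_prod, Int.cast_prod]
  refine Finset.prod_congr rfl fun i _ => ?_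
  have h : IsUnit (i : ZMod (p ^ k)) ↔ i.Coprime p := by
    rw [ZMod.isUnit_iff_coprime, Nat.coprime_pow_right_iff (Nat.pos_of_ne_zero hk)]
  rw [gammaFactor]
  by_cases hi : i.Coprime p
  · rw [if_pos hi, if_pos (h.2 hi)]
    push_cast
    rfl
  · rw [if_neg hi, if_neg (fun hu => hi (h.1 hu))]
    push_cast
    rfl

theorem prod_gammaFactor (hp2 : p ≠ 2) (k : ℕ) :
    ∏ i ∈ Finset.range (p ^ k), gammaFactor (p ^ k) (i : ZMod (p ^ k)) = 1 := by
  classical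
  have hp := (Fact.out : p.Prime)
  have : NeZero (p ^ k) := ⟨(pow_pos hp.pos k).ne'⟩
  have h1 : ∏ i ∈ Finset.range (p ^ k), gammaFactor (p ^ k) (i : ZMod (p ^ k))
      = ∏ x : ZMod (p ^ k), gammaFactor (p ^ k) x := by
    refine Finset.prod_bij (fun i _ => (i : ZMod (p ^ k))) (fun _ _ => Finset.mem_univ _)
      (fun a ha b hb h => ?_) (fun x _ => ⟨x.val, ?_, ?_⟩) fun _ _ => rfl
    · rw [ZMod.natCast_eq_natCast_iff'] at h
      simp only [Finset.mem_range] at ha hb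
      rwa [Nat.mod_eq_of_lt ha, Nat.mod_eq_of_lt hb] at h
    · simpa using ZMod.val_lt x
    · simp
  have h2 := Fintype.prod_of_injective (Units.val : (ZMod (p ^ k))ˣ → ZMod (p ^ k))
    (fun _ _ h => Units.ext h) (fun u => (u : ZMod (p ^ k))) (fun x => if IsUnit x then x else 1)
    (fun x hx => if_neg fun ⟨u, hu⟩ => hx ⟨u, hu⟩) (fun u => by simp)
  have h3 : ∏ u : (ZMod (p ^ k))ˣ, (u : ZMod (p ^ k)) = -1 := by
    have := congrArg Units.val (prod_units_zmod_prime_pow hp2 k)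
    simpa using this
  rw [h1]
  simp only [gammaFactor]
  rw [Finset.prod_neg, Finset.card_univ, ZMod.card,
    ((hp.odd_of_ne_two hp2).pow).neg_one_pow]
  rw [h3] at h2
  have h4 : (-1 : ZMod (p ^ k)) * ∏ x : ZMod (p ^ k), (if IsUnit x then x else 1) = 1 := by
    rw [← h2]
    norm_num
  convert h4

/-- A full period contributes 1: Wilson's -1 is cancelled by the sign (-1)^(p^k). This periodicity
gives the uniform continuity from which the limit exists. -/
theorem padicGammaNat_cast_add (hp2 : p ≠ 2) {k : ℕ} (hk : k ≠ 0) (m : ℕ) :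
    ((padicGammaNat p (m + p ^ k) : ℤ) : ZMod (p ^ k)) = (padicGammaNat p m : ℤ) := by
  rw [padicGammaNat_cast hk, padicGammaNat_cast hk]
  induction m with
  | zero => simpa using prod_gammaFactor hp2 k
  | succ m ih =>
    rw [show m + 1 + p ^ k = m + p ^ k + 1 by ring, Finset.prod_range_succ, ih,
      Finset.prod_range_succ]
    congr 2
    rw [Nat.cast_add, ZMod.natCast_self, add_zero]

theorem padicGammaNat_cast_mod (hp2 : p ≠ 2) {k : ℕ} (hk : k ≠ 0) (m : ℕ) :
    ((padicGammaNat p m : ℤ) : ZMod (p ^ k)) = (padicGammaNat p (m % p ^ k) : ℤ) := by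
  have h (r t : ℕ) : ((padicGammaNat p (r + p ^ k * t) : ℤ) : ZMod (p ^ k))
      = (padicGammaNat p r : ℤ) := by
    induction t with
    | zero => simp
    | succ t ih => rw [mul_add, mul_one, ← add_assoc, padicGammaNat_cast_add hp2 hk, ih]
  conv_lhs => rw [← Nat.mod_add_div m (p ^ k)]
  exact h _ _

theorem norm_padicGammaNat_sub_le (hp2 : p ≠ 2) {k a b : ℕ} (hk : k ≠ 0)
    (h : ‖(a : ℤ_[p]) - b‖ ≤ (p : ℝ) ^ (-k : ℤ)) :
    ‖((padicGammaNat p a : ℤ) : ℤ_[p]) - (padicGammaNat p b : ℤ)‖ ≤ (p : ℝ) ^ (-k : ℤ) := by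
  have h1 : ((p ^ k : ℕ) : ℤ) ∣ (a : ℤ) - b := by
    rw [Nat.cast_pow, ← PadicInt.norm_int_le_pow_iff_dvd]
    push_cast
    exact h
  have h2 : b % p ^ k = a % p ^ k := by
    have := (ZMod.intCast_eq_intCast_iff_dvd_sub (b : ℤ) a (p ^ k)).2 h1
    exact (ZMod.natCast_eq_natCast_iff' b a (p ^ k)).1 (by exact_mod_cast this)
  have h3 : ((padicGammaNat p b : ℤ) : ZMod (p ^ k)) = (padicGammaNat p a : ℤ) := by
    rw [padicGammaNat_cast_mod hp2 hk b, padicGammaNat_cast_mod hp2 hk a, h2]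
  have h4 := (ZMod.intCast_eq_intCast_iff_dvd_sub _ _ (p ^ k)).1 h3
  rw [Nat.cast_pow, ← PadicInt.norm_int_le_pow_iff_dvd] at h4
  push_cast at h4
  exact h4

theorem eventually_comap_natCast_norm_sub_le (x : ℤ_[p]) {ε : ℝ} (hε : 0 < ε) :
    ∀ᶠ m : ℕ in Filter.comap (fun m : ℕ => (m : ℤ_[p])) (nhds x), ‖(m : ℤ_[p]) - x‖ ≤ ε := by
  have : ∀ᶠ y in nhds x, ‖y - x‖ ≤ ε := by
    filter_upwards [Metric.ball_mem_nhds x hε] with y hy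
    rw [Metric.mem_ball, dist_eq_norm] at hy
    exact hy.le
  exact this.comap _

theorem comap_natCast_neBot (x : ℤ_[p]) :
    (Filter.comap (fun m : ℕ => (m : ℤ_[p])) (nhds x)).NeBot := by
  refine Filter.comap_neBot fun t ht => ?_
  obtain ⟨y, hy, ⟨m, rfl⟩⟩ := mem_closure_iff_nhds.1 (PadicInt.denseRange_natCast x) t ht
  exact ⟨m, hy⟩

theorem norm_natCast_sub_natCast_le {x : ℤ_[p]} {a b : ℕ} {r : ℝ} (ha : ‖(a : ℤ_[p]) - x‖ ≤ r)
    (hb : ‖(b : ℤ_[p]) - x‖ ≤ r) : ‖(a : ℤ_[p]) - b‖ ≤ r := by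
  rw [show (a : ℤ_[p]) - b = (a - x) + -(b - x) by ring]
  refine (PadicInt.nonarchimedean _ _).trans (max_le ha ?_)
  rwa [norm_neg]

theorem tendsto_padicGamma (hp2 : p ≠ 2) (x : ℤ_[p]) :
    Filter.Tendsto (fun m : ℕ => ((padicGammaNat p m : ℤ) : ℤ_[p]))
      (Filter.comap (fun m : ℕ => (m : ℤ_[p])) (nhds x)) (nhds (padicGamma p x)) := by
  have := comap_natCast_neBot x
  have hp1 : (1 : ℝ) < p := by exact_mod_cast (Fact.out : p.Prime).one_lt
  have hpos (k : ℕ) : (0 : ℝ) < (p : ℝ) ^ (-k : ℤ) := zpow_pos (by linarith) _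
  refine tendsto_nhds_limUnder (cauchy_map_iff_exists_tendsto.1 ?_)
  refine Metric.cauchy_iff.2 ⟨inferInstance, fun ε hε => ?_⟩
  obtain ⟨k, hk⟩ := exists_pow_lt_of_lt_one hε (inv_lt_one_of_one_lt₀ hp1)
  have hk' : (p : ℝ) ^ (-(k + 1 : ℕ) : ℤ) < ε := by
    refine lt_of_le_of_lt ?_ hk
    rw [zpow_neg, zpow_natCast, inv_pow]
    exact inv_anti₀ (by positivity) (pow_le_pow_right₀ hp1.le (Nat.le_succ k))
  refine ⟨_, Filter.image_mem_map (eventually_comap_natCast_norm_sub_le x (hpos (k + 1))), ?_⟩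
  rintro _ ⟨a, ha, rfl⟩ _ ⟨b, hb, rfl⟩
  rw [dist_eq_norm]
  exact (norm_padicGammaNat_sub_le hp2 k.succ_ne_zero
    (norm_natCast_sub_natCast_le ha hb)).trans_lt hk'

theorem norm_padicGamma_sub_le (hp2 : p ≠ 2) {x : ℤ_[p]} {k N : ℕ} (hk : k ≠ 0)
    (h : ‖(N : ℤ_[p]) - x‖ ≤ (p : ℝ) ^ (-k : ℤ)) :
    ‖padicGamma p x - (padicGammaNat p N : ℤ)‖ ≤ (p : ℝ) ^ (-k : ℤ) := by
  have := comap_natCast_neBot x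
  have hp1 : (1 : ℝ) < p := by exact_mod_cast (Fact.out : p.Prime).one_lt
  refine le_of_tendsto ((tendsto_padicGamma hp2 x).sub_const _).norm ?_
  filter_upwards [eventually_comap_natCast_norm_sub_le x (zpow_pos (by linarith : (0 : ℝ) < p)
    (-k : ℤ))] with m hm
  exact norm_padicGammaNat_sub_le hp2 hk (norm_natCast_sub_natCast_le hm h)

theorem padicCongr_coe_iff {k : ℕ} {x y : ℤ_[p]} :
    PadicCongr p k (x : ℚ_[p]) y ↔ ‖x - y‖ ≤ (p : ℝ) ^ (-k : ℤ) := by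
  rw [PadicInt.norm_le_pow_iff_mem_span_pow, Ideal.mem_span_singleton']
  constructor
  · rintro ⟨z, hz⟩
    refine ⟨z, ?_⟩
    apply PadicInt.ext
    push_cast
    rw [hz, mul_comm]
  · rintro ⟨z, hz⟩
    refine ⟨z, ?_⟩
    have := congrArg (fun t : ℤ_[p] => (t : ℚ_[p])) hz
    push_cast at this
    rw [← this, mul_comm]

theorem padicGamma_congr (hp2 : p ≠ 2) {x : ℤ_[p]} {k N : ℕ} (hk : k ≠ 0)
    (h : PadicCongr p k (N : ℚ_[p]) x) :
    PadicCongr p k (padicGamma p x : ℚ_[p]) ((padicGammaNat p N : ℤ) : ℚ_[p]) := by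
  have h1 : PadicCongr p k (((N : ℤ_[p]) : ℚ_[p])) x := by simpa using h
  have := padicCongr_coe_iff.2 (norm_padicGamma_sub_le hp2 hk (padicCongr_coe_iff.1 h1))
  simpa using this

end Wilson

/-! ### The fourth power of Γ_p(1/4) modulo p^2. -/

section Value

variable {p : ℕ} [Fact p.Prime]

theorem padicGammaNat_succ (m : ℕ) :
    padicGammaNat p (m + 1) = padicGammaNat p m * -(if Nat.Coprime m p then (m : ℤ) else 1) := by
  rw [padicGammaNat_eq_prod, padicGammaNat_eq_prod, Finset.prod_range_succ]

theorem padicGammaNat_block (b r : ℕ) (hr : r < p) :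
    padicGammaNat p (p * b + (r + 1))
      = padicGammaNat p (p * b) * ((-1) ^ (r + 1) * ∏ i ∈ Finset.range r, ((p : ℤ) * b + (i + 1))) := by
  have hp := (Fact.out : p.Prime)
  induction r with
  | zero =>
    have : ¬ Nat.Coprime (p * b) p := fun h => by
      rw [Nat.coprime_mul_iff_left, Nat.coprime_self] at h
      exact hp.one_lt.ne' h.1
    rw [zero_add, padicGammaNat_succ, if_neg this]
    simp
  | succ r ih =>
    have : Nat.Coprime (p * b + (r + 1)) p := by
      rw [Nat.coprime_mul_left_add_left]
      exact (Nat.coprime_of_lt_prime (by omega) hr hp).symm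
    rw [show p * b + (r + 1 + 1) = p * b + (r + 1) + 1 by ring, padicGammaNat_succ, if_pos this,
      ih (by omega), Finset.prod_range_succ]
    push_cast
    ring

theorem prod_block_congr (b : ℕ) {r : ℕ} (hr : r < p) :
    PadicCongr p 2 (∏ i ∈ Finset.range r, ((p : ℚ_[p]) * b + (i + 1)))
      (r.factorial * (1 + p * (b * harm ℚ_[p] r))) := by
  refine (prod_mul_one_add_p_mul (Finset.range r) (c := fun i => ((i + 1 : ℕ) : ℚ_[p]))
    (a := fun i => (b : ℚ_[p]) * (1 / ((i : ℚ_[p]) + 1))) (fun i hi => ?_)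
    (fun _ _ => natCast_mem _ _) fun i _ => ?_).trans (PadicCongr.of_eq ?_)
  · rw [one_div]
    exact mul_mem (natCast_mem _ _) (inv_mem_of_eq_natCast (a := i + 1) (by push_cast; ring)
      (by omega) (by simp at hi; omega))
  · have : (i : ℚ_[p]) + 1 ≠ 0 := by exact_mod_cast i.succ_ne_zero
    push_cast
    field_simp
    ring
  · rw [← Finset.mul_sum, ← Nat.cast_prod, Finset.prod_range_add_one_eq_factorial, harm]

/-- Pair i with p-i. -/
theorem harm_pred_congr (hp2 : p ≠ 2) : PadicCongr p 1 (harm ℚ_[p] (p - 1)) 0 := by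
  have h2 : 2 * harm ℚ_[p] (p - 1) = p * ∑ i ∈ Finset.range (p - 1),
      (((i + 1 : ℕ) : ℚ_[p])⁻¹ * ((p - (i + 1) : ℕ) : ℚ_[p])⁻¹) := by
    rw [two_mul, harm]
    nth_rewrite 2 [← Finset.sum_range_reflect]
    rw [← Finset.sum_add_distrib, Finset.mul_sum]
    refine Finset.sum_congr rfl fun i hi => ?_
    have hi' : i + 1 < p := by simp at hi; omega
    obtain ⟨d, hd⟩ : ∃ d, p = i + 1 + (d + 1) := ⟨p - i - 2, by omega⟩
    have hpc : (p : ℚ_[p]) = i + 1 + (d + 1) := by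
      exact_mod_cast congrArg (Nat.cast (R := ℚ_[p])) hd
    rw [show p - 1 - 1 - i = d by omega, show p - (i + 1) = d + 1 by omega, hpc]
    have h1 : (i : ℚ_[p]) + 1 ≠ 0 := by exact_mod_cast i.succ_ne_zero
    have h2 : (d : ℚ_[p]) + 1 ≠ 0 := by exact_mod_cast d.succ_ne_zero
    push_cast
    field_simp
    ring
  refine PadicCongr.cancel two_ne_zero (inv_two_mem hp2) (padicCongr_of_eq
    (z := ∑ i ∈ Finset.range (p - 1), (((i + 1 : ℕ) : ℚ_[p])⁻¹ * ((p - (i + 1) : ℕ) : ℚ_[p])⁻¹))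
    (sum_mem fun i hi => mul_mem (inv_natCast_mem_of_lt (by omega) (by simp at hi; omega))
      (inv_natCast_mem_of_lt (by simp at hi; omega) (by simp at hi; omega))) ?_)
  rw [h2]
  ring

/-- Each block of p consecutive integers contributes -(p-1)!, because its first-order correction is
a multiple of pH_{p-1} and so vanishes modulo p^2. -/
theorem padicGammaNat_mul_congr (hp2 : p ≠ 2) (b : ℕ) :
    PadicCongr p 2 ((padicGammaNat p (p * b) : ℤ) : ℚ_[p])
      ((-((p - 1).factorial : ℚ_[p])) ^ b) := by
  have hp := (Fact.out : p.Prime)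
  induction b with
  | zero => exact PadicCongr.of_eq (by simp [padicGammaNat])
  | succ b ih =>
    have h0 := (((harm_pred_congr hp2).mul_left (natCast_mem _ b)).p_mul.add
      (PadicCongr.refl 1)).mul_left (natCast_mem _ (p - 1).factorial)
    have h1 : PadicCongr p 2 (∏ i ∈ Finset.range (p - 1), ((p : ℚ_[p]) * b + (i + 1)))
        ((p - 1).factorial : ℚ_[p]) :=
      (prod_block_congr b (show p - 1 < p by have := hp.pos; omega)).trans
        ((PadicCongr.of_eq (by ring)).trans (h0.trans (PadicCongr.of_eq (by ring))))
    rw [show p * (b + 1) = p * b + (p - 1 + 1) by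
      rw [Nat.sub_add_cancel hp.pos]; ring,
      padicGammaNat_block b (p - 1) (by have := hp.pos; omega), Nat.sub_add_cancel hp.pos,
      (hp.odd_of_ne_two hp2).neg_one_pow, pow_succ]
    push_cast
    refine ih.mul (intCast_mem _ _) ?_ ?_
    · exact_mod_cast intCast_mem (PadicInt.subring p) (-1 * ∏ i ∈ Finset.range (p - 1),
        ((p : ℤ) * b + (i + 1)))
    · refine (PadicCongr.of_eq ?_).trans h1.neg
      ring

/-- Raising Wilson's congruence to the p-th power gains one power of p. -/
theorem factorial_pred_pow_congr (hp2 : p ≠ 2) :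
    PadicCongr p 2 (((p - 1).factorial : ℚ_[p]) ^ p) (-1) := by
  have hp := (Fact.out : p.Prime)
  have h1 : (p : ℤ) ∣ ((p - 1).factorial : ℤ) - (-1) := by
    have := ZMod.wilsons_lemma p
    rw [← ZMod.intCast_zmod_eq_zero_iff_dvd]
    push_cast
    rw [this]
    ring
  obtain ⟨z, hz⟩ := dvd_sub_pow_of_dvd_sub h1 1
  rw [pow_one, (hp.odd_of_ne_two hp2).neg_one_pow] at hz
  refine padicCongr_of_eq (intCast_mem _ z) ?_
  exact_mod_cast congrArg (Int.cast (R := ℚ_[p])) hz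

theorem padicGamma_quarter_congr {n : ℕ} (hp : p = 4 * n + 3) (hp2 : p ≠ 2) :
    PadicCongr p 2 ((padicGamma p (padicQuarter p hp2) : ℚ_[p]) ^ 4)
      (-((n.factorial : ℚ_[p]) ^ 4 * (1 - p * harm ℚ_[p] n) *
        ((p - 1).factorial : ℚ_[p])⁻¹)) := by
  have hpc : (p : ℚ_[p]) = 4 * n + 3 := by exact_mod_cast congrArg (Nat.cast (R := ℚ_[p])) hp
  have hq : ((padicQuarter p hp2 : ℤ_[p]) : ℚ_[p]) = 1 / 4 := rfl
  have mn := harm_mem (p := p) (show n < p by omega)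
  have mp : (p : ℚ_[p]) ∈ PadicInt.subring p := natCast_mem _ p
  have mW := inv_factorial_mem (p := p) (show p - 1 < p by omega)
  have hW : ((p - 1).factorial : ℚ_[p]) ≠ 0 := by exact_mod_cast Nat.factorial_ne_zero _
  -- This N satisfies N - 1/4 = 3p^2/4, and its base-p shape displays 3n+2 full blocks.
  have h1 := padicGamma_congr (p := p) hp2 (k := 2) (N := p * (3 * n + 2) + (n + 1))
    (x := padicQuarter p hp2) two_ne_zero (by
      refine padicCongr_of_eq (z := 4⁻¹ * (3 : ℕ)) (mul_mem (inv_four_mem hp2)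
        (natCast_mem _ 3)) ?_
      rw [hq]
      push_cast
      rw [hpc]
      ring)
  rw [padicGammaNat_block _ _ (by omega)] at h1
  push_cast at h1
  have h2 := (padicGammaNat_mul_congr hp2 (3 * n + 2)).mul (intCast_mem _ _) ?_
    ((prod_block_congr (3 * n + 2) (show n < p by omega)).mul_left
      (pow_mem (neg_mem (one_mem (PadicInt.subring p))) (n + 1)))
  · push_cast at h2
    have h3 := (h1.trans h2).pow (padicGamma p (padicQuarter p hp2)).2 4
    -- fourth power of `1 + p b H`
    have h4 : PadicCongr p 2 ((1 + p * ((3 * n + 2) * harm ℚ_[p] n)) ^ 4)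
        (1 - p * harm ℚ_[p] n) := by
      have mb : (3 * (n : ℚ_[p]) + 2) * harm ℚ_[p] n ∈ PadicInt.subring p :=
        mul_mem (by exact_mod_cast natCast_mem (PadicInt.subring p) (3 * n + 2)) mn
      have m (k : ℕ) : (k : ℚ_[p]) ∈ PadicInt.subring p := natCast_mem _ k
      refine padicCongr_of_eq (add_mem (mul_mem (m 3) mn) (add_mem (add_mem
        (mul_mem (m 6) (pow_mem mb 2)) (mul_mem (mul_mem (m 4) mp) (pow_mem mb 3)))
        (mul_mem (pow_mem mp 2) (pow_mem mb 4)))) ?_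
      -- The relation 4(3n+2) = 3p-1 makes the harmonic coefficient -1 modulo p; it also turns the
      -- power of (p-1)! in the next step into ((p-1)!^p)^3/(p-1)!.
      have e : 4 * (3 * (n : ℚ_[p]) + 2) = 3 * p - 1 := by rw [hpc]; ring
      push_cast
      linear_combination p * harm ℚ_[p] n * e
    have h5 : PadicCongr p 2 (((p - 1).factorial : ℚ_[p]) ^ (4 * (3 * n + 2)))
        (-((p - 1).factorial : ℚ_[p])⁻¹) := by
      have h := ((factorial_pred_pow_congr hp2).pow (pow_mem (natCast_mem _ _) p) 3).mul_left mW
      refine (PadicCongr.of_eq ?_).trans (h.trans (PadicCongr.of_eq ?_))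
      · rw [eq_inv_mul_iff_mul_eq₀ hW, ← pow_succ', ← pow_mul]
        congr 1
        omega
      · ring
    have h6 := h5.mul (pow_mem (natCast_mem _ _) _) (pow_mem (add_mem (one_mem _)
      (mul_mem mp (mul_mem (by exact_mod_cast natCast_mem (PadicInt.subring p) (3 * n + 2))
        mn))) 4) h4
    have h7 := h6.mul_left (pow_mem (natCast_mem _ n.factorial) 4)
    refine h3.trans ((PadicCongr.of_eq ?_).trans (h7.trans (PadicCongr.of_eq ?_)))
    · have e1 : ((-1 : ℚ_[p]) ^ (n + 1)) ^ 4 = 1 := by rw [← pow_mul, mul_comm, pow_mul]; norm_num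
      have e2 : ((-((p - 1).factorial : ℚ_[p])) ^ (3 * n + 2)) ^ 4
          = ((p - 1).factorial : ℚ_[p]) ^ (4 * (3 * n + 2)) := by
        rw [← pow_mul, mul_comm (3 * n + 2) 4, Even.neg_pow ⟨2 * (3 * n + 2), by ring⟩]
      rw [mul_pow, mul_pow, mul_pow, e1, e2]
      ring
    · ring
  · exact_mod_cast intCast_mem (PadicInt.subring p) ((-1) ^ (n + 1) * ∏ i ∈ Finset.range n,
      ((p : ℤ) * (3 * n + 2 : ℕ) + (i + 1)))

end Value

/-! ### Translation to the stated sums and conclusion. -/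

section Exact

variable {K : Type*} [Field K] [CharZero K]

theorem ascPochhammer_eval_half_div_factorial (k : ℕ) :
    (ascPochhammer K k).eval (1 / 2) / (k.factorial : K) = halfBinom K k := by
  have hf : (k.factorial : K) ≠ 0 := by exact_mod_cast Nat.factorial_ne_zero k
  rw [div_eq_iff hf, mul_comm, ← prod_add_half]
  induction k with
  | zero => simp
  | succ k ih =>
    rw [ascPochhammer_succ_eval, ih (by exact_mod_cast Nat.factorial_ne_zero k),
      Finset.prod_range_succ, add_comm (k : K)]

theorem centralBinomSqSum_cast (n : ℕ) : (centralBinomSqSum n : K) = halfBinomSqSum K n := by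
  rw [centralBinomSqSum, halfBinomSqSum]
  push_cast
  refine Finset.sum_congr rfl fun k _ => ?_
  rw [halfBinom, div_pow, ← pow_mul, mul_comm k 2, pow_mul, Nat.centralBinom]
  norm_num

end Exact

theorem theorem4 (p : ℕ) [Fact p.Prime] (hp : 5 ≤ p) (hp4 : p % 4 = 3) :
    PadicCongr p 4
      (∑ k ∈ Finset.range ((p - 1) / 2 + 1),
        ((ascPochhammer ℚ_[p] k).eval (1 / 2) / (k.factorial : ℚ_[p])) ^ 3)
      (-((p : ℚ_[p]) ^ 2 / 4) *
        (padicGamma p (padicQuarter p (by omega)) : ℚ_[p]) ^ 4 *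
        (centralBinomSqSum ((p - 3) / 4) : ℚ_[p]) ^ 2) ∧
    PadicCongr p 1 (centralBinomSqSum ((p - 3) / 4) : ℚ_[p]) (-1 / 2) := by
  obtain ⟨n, hn⟩ : ∃ n, p = 4 * n + 3 := ⟨p / 4, by omega⟩
  have hp2 : p ≠ 2 := by omega
  have hi := inv_two_mem hp2
  have hi4 := inv_four_mem hp2
  have mp : (p : ℚ_[p]) ∈ PadicInt.subring p := natCast_mem _ p
  have mA := harmDefect_mem hn
  have mm := harm_mem (p := p) (show 2 * n + 1 < p by omega)
  have m2 : (2 : ℚ_[p]) ∈ PadicInt.subring p := natCast_mem _ 2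
  have mG := (padicGamma p (padicQuarter p hp2)).2
  rw [centralBinomSqSum_cast, show (p - 3) / 4 = n by omega,
    show (p - 1) / 2 + 1 = 2 * n + 2 by omega,
    Finset.sum_congr rfl fun k _ => by rw [ascPochhammer_eval_half_div_factorial k]]
  have hJ := halfBinomSqSum_congr hn
  have mJ : 2 * halfBinomSqSum ℚ_[p] n ∈ PadicInt.subring p :=
    hJ.mem_iff.2 (add_mem (neg_mem (one_mem _)) (mul_mem mp mA))
  constructor
  · refine (sum_halfBinom_cube_congr hn).trans ?_
    have mK := cubeUnit_mem hn
    have hG := (cubeUnit_congr hn).trans ((padicGamma_quarter_congr hn hp2).symm.mul_left hi4)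
    have hJ2 := (hJ.pow mJ 2).mul_left (mul_mem (neg_mem hi4) (pow_mem mG 4))
    have h1 := hG.mul_left (neg_mem (pow_mem (add_mem (neg_mem (one_mem _)) (mul_mem mp mA)) 2))
    set a := harm ℚ_[p] (2 * n + 1) with ha
    set A := harmDefect ℚ_[p] n with hA
    -- To first order -1 + p(2A-a) = -(1-pA)^2 (1+pa), which separates (2J)^2 from the Gamma factor.
    have h2 : PadicCongr p 2 (cubeUnit ℚ_[p] n * (-1 + p * (2 * A - a)))
        (-(-1 + p * A) ^ 2 * (cubeUnit ℚ_[p] n * (1 + p * a))) :=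
      padicCongr_of_eq (z := cubeUnit ℚ_[p] n * (A ^ 2 - 2 * A * a + p * A ^ 2 * a)) (by
        exact mul_mem mK (add_mem (sub_mem (pow_mem mA 2) (mul_mem (mul_mem m2 mA) mm))
          (mul_mem (mul_mem mp (pow_mem mA 2)) mm))) (by ring)
    have h3 := (((h2.trans (h1.trans ((PadicCongr.of_eq (by ring)).trans hJ2.symm))).mul_left
      hi4).pow_mul 2)
    refine (PadicCongr.of_eq (by ring)).trans (h3.trans (PadicCongr.of_eq ?_))
    ring
  · refine PadicCongr.cancel two_ne_zero hi ((hJ.mono one_le_two).trans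
      (padicCongr_of_eq mA ?_))
    ring
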